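/- A \emph{single-path linear-constraint loop with precondition} over variables $x=(x_1,\dots,x_n)$ has the form $$ Cx\le c;\quad \mathit{while}\ (Bx\le b)\ \mathit{do}\ A\begin{pmatrix}x\\x'\end{pmatrix}\le a ,$$ where $C\in\mathbb Z^{r\times n}$, $B\in\mathbb Z^{p\times n}$, $A\in\mathbb Z^{q\times 2n}$, $c\in\mathbb Z^r$, $b\in\mathbb Z^p$, $a\in\mathbb Z^q$ and $p,q,r>0$; as an input it is represented by these matrices and vectors, with numbers in binary. It is interpreted over the rationals: states are the points of $\mathbb Q^n$, the initial states are those with $Cx\le c$, and there is a transition from $x$ to $x'$ if $Bx\le b$ and $A\binom{x}{x'}\le a$. A state is \emph{reachable} if a finite (possibly empty) sequence of consecutive transitions leads to it from an initial state, and a transition is \emph{reachable} if its source is. The loop is \emph{deterministic} if for every reachable state $x$ with $Bx\le b$ there is at most one $x'$ with $A\binom{x}{x'}\le a$. A \emph{linear ranking function} for the loop is an affine function $\rho(x)=\lambda\cdot x+\lambda_0$ ($\lambda\in\mathbb Q^n$, $\lambda_0\in\mathbb Q$) such that $\rho(x)\ge 0$ and $\rho(x)-\rho(x')\ge 1$ for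 every reachable transition from $x$ to $x'$. The problem $\mathrm{LinRF}_{\mathbb Q}$ asks, given such a loop, whether it has a linear ranking function. \textbf{Corollary.} $\mathrm{LinRF}_{\mathbb Q}$ is PSPACE-hard, even when restricted to deterministic loops: every language $L\subseteq\{0,1\}^*$ in PSPACE has a polynomial-time many-one reduction to $\mathrm{LinRF}_{\mathbb Q}$, and it even has one all of whose values are deterministic loops. -/

import Mathlib

open Computability

/-! ### Single-path linear-constraint loops with a precondition -/

/-- A single-path linear-constraint loop with precondition over `n` variables,
`C x ≤ c; while (B x ≤ b) do A (x, x') ≤ a`, with integer data. The columns of `A` are indexed by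
`Fin n ⊕ Fin n`: first the `n` variables `x`, then the `n` variables `x'`. -/
structure SLCLoop where
  /-- number of variables -/
  n : ℕ
  /-- number of constraints in the precondition -/
  r : ℕ
  /-- number of constraints in the loop condition -/
  p : ℕ
  /-- number of constraints in the update -/
  q : ℕ
  r_pos : 0 < r
  p_pos : 0 < p
  q_pos : 0 < q
  C : Matrix (Fin r) (Fin n) ℤ
  c : Fin r → ℤ
  B : Matrix (Fin p) (Fin n) ℤ
  b : Fin p → ℤ
  A : Matrix (Fin q) (Fin n ⊕ Fin n) ℤ
  a : Fin q → ℤ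

namespace SLCLoop

/-- The states of the loop interpreted over the rationals. -/
abbrev State (l : SLCLoop) : Type := Fin l.n → ℚ

/-- The precondition `C x ≤ c`. -/
def Initial (l : SLCLoop) (x : l.State) : Prop :=
  ∀ i, ∑ j, (l.C i j : ℚ) * x j ≤ (l.c i : ℚ)

/-- The loop condition `B x ≤ b`. -/
def Guard (l : SLCLoop) (x : l.State) : Prop :=
  ∀ i, ∑ j, (l.B i j : ℚ) * x j ≤ (l.b i : ℚ)

/-- The update `A (x, x') ≤ a`. -/
def Update (l : SLCLoop) (x x' : l.State) : Prop :=
  ∀ i, ∑ j, (l.A i j : ℚ) * Sum.elim x x' j ≤ (l.a i : ℚ)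

/-- There is a transition from `x` to `x'`. -/
def Trans (l : SLCLoop) (x x' : l.State) : Prop :=
  l.Guard x ∧ l.Update x x'

/-- `x` appears in some computation, that is, in some sequence of consecutive transitions that
starts at an initial state. -/
def Reachable (l : SLCLoop) (x : l.State) : Prop :=
  ∃ x₀, l.Initial x₀ ∧ Relation.ReflTransGen l.Trans x₀ x

/-- The set of reachable transitions. -/
def reachableTrans (l : SLCLoop) : Set (l.State × l.State) :=
  {t | l.Reachable t.1 ∧ l.Trans t.1 t.2}

/-- The loop is deterministic: a reachable state that satisfies the loop condition has at
most one successor. -/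
def Deterministic (l : SLCLoop) : Prop :=
  ∀ x, l.Reachable x → l.Guard x →
    ∀ x' x'', l.Update x x' → l.Update x x'' → x' = x''

end SLCLoop

/-- The affine linear function `x ↦ lam ⬝ x + lam₀` is a linear ranking function for the set `T`
of transitions. -/
def IsLinearRankingFunction {n : ℕ} (lam : Fin n → ℚ) (lam₀ : ℚ)
    (T : Set ((Fin n → ℚ) × (Fin n → ℚ))) : Prop :=
  ∀ x x', (x, x') ∈ T →
    0 ≤ (∑ j, lam j * x j + lam₀) ∧
    1 ≤ (∑ j, lam j * x j + lam₀) - (∑ j, lam j * x' j + lam₀)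

/-- The yes-instances of the problem `LinRF_ℚ` (with precondition): the loop has a linear ranking
function for its reachable transitions. -/
def SLCLoop.LinRF (l : SLCLoop) : Prop :=
  ∃ (lam : Fin l.n → ℚ) (lam₀ : ℚ), IsLinearRankingFunction lam lam₀ l.reachableTrans

/-! ### Representation of a loop as an input: matrices and vectors, numbers in binary -/

/-- The alphabet in which loops are written. -/
inductive LoopSym
  | zero | one | minus | endNum | endRow | endSystem
  deriving DecidableEq

/-- An integer: an optional minus sign, the binary digits of the absolute value (least significant
first, none for `0`), and an end marker. -/
def encodeInt (z : ℤ) : List LoopSym :=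
  (if z < 0 then [LoopSym.minus] else []) ++
    z.natAbs.bits.map (fun d => if d then LoopSym.one else LoopSym.zero) ++ [LoopSym.endNum]

/-- A constraint, given as the list of its coefficients followed by its right-hand side. -/
def encodeRow (v : List ℤ) : List LoopSym :=
  v.flatMap encodeInt ++ [LoopSym.endRow]

/-- A list of constraints. -/
def encodeSystem (rows : List (List ℤ)) : List LoopSym :=
  rows.flatMap encodeRow ++ [LoopSym.endSystem]

namespace SLCLoop

/-- The rows of `(C | c)`. -/
def preRows (l : SLCLoop) : List (List ℤ) :=
  List.ofFn fun i => List.ofFn (l.C i) ++ [l.c i]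

/-- The rows of `(B | b)`. -/
def guardRows (l : SLCLoop) : List (List ℤ) :=
  List.ofFn fun i => List.ofFn (l.B i) ++ [l.b i]

/-- The rows of `(A | a)`. -/
def updateRows (l : SLCLoop) : List (List ℤ) :=
  List.ofFn fun i =>
    List.ofFn (fun j => l.A i (Sum.inl j)) ++ List.ofFn (fun j => l.A i (Sum.inr j)) ++ [l.a i]

/-- The representation of a loop as a word. -/
def encode (l : SLCLoop) : List LoopSym :=
  encodeSystem l.preRows ++ encodeSystem l.guardRows ++ encodeSystem l.updateRows

end SLCLoop

/-! The representation is unambiguous. -/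

theorem encodeInt_append_inj {y z : ℤ} {u v : List LoopSym}
    (h : encodeInt y ++ u = encodeInt z ++ v) : y = z ∧ u = v := by
  have key : ∀ (s t : List Bool) (u v : List LoopSym),
      s.map (fun d => if d then LoopSym.one else LoopSym.zero) ++ LoopSym.endNum :: u =
        t.map (fun d => if d then LoopSym.one else LoopSym.zero) ++ LoopSym.endNum :: v →
      s = t ∧ u = v := by
    intro s
    induction s with
    | nil =>
      intro t u v h
      cases t with
      | nil => simpa using h
      | cons d t => cases d <;> simp at h
    | cons d s ih =>
      intro t u v h
      cases t with
      | nil => cases d <;> simp at h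
      | cons e t =>
        cases d <;> cases e <;> simp at h <;> simpa using ih t u v (by simpa using h)
  have bits_inj : ∀ {m k : ℕ}, m.bits = k.bits → m = k := by
    intro m k h
    rw [← Nat.ofDigits_digits 2 m, ← Nat.ofDigits_digits 2 k, Nat.digits_two_eq_bits,
      Nat.digits_two_eq_bits, h]
  have nominus : ∀ (s : List Bool) (u v : List LoopSym),
      s.map (fun d => if d then LoopSym.one else LoopSym.zero) ++ LoopSym.endNum :: u ≠
        LoopSym.minus :: v := by
    intro s u v h
    cases s with
    | nil => simp at h
    | cons d s => cases d <;> simp at h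
  unfold encodeInt at h
  by_cases hy : y < 0 <;> by_cases hz : z < 0 <;>
    simp only [hy, hz, if_true, if_false, List.append_assoc, List.cons_append, List.nil_append] at h
  · obtain ⟨h1, h2⟩ := key _ _ _ _ (List.cons.inj h).2
    exact ⟨by have := bits_inj h1; omega, h2⟩
  · exact absurd h.symm (nominus _ _ _)
  · exact absurd h (nominus _ _ _)
  · obtain ⟨h1, h2⟩ := key _ _ _ _ h
    exact ⟨by have := bits_inj h1; omega, h2⟩

/-- A list of words of an unambiguous code, closed by a marker that starts none of them, is
unambiguous. -/
theorem flatMap_append_inj {α : Type*} (f : α → List LoopSym) (s : LoopSym)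
    (hf : ∀ x y u v, f x ++ u = f y ++ v → x = y ∧ u = v)
    (hs : ∀ x u v, f x ++ u ≠ s :: v) :
    ∀ (l m : List α) (u v : List LoopSym),
      l.flatMap f ++ [s] ++ u = m.flatMap f ++ [s] ++ v → l = m ∧ u = v := by
  intro l
  induction l with
  | nil =>
    intro m u v h
    cases m with
    | nil => simpa using h
    | cons y m =>
      simp only [List.flatMap_cons, List.flatMap_nil, List.append_assoc, List.nil_append,
        List.cons_append] at h
      exact absurd h.symm (hs _ _ _)
  | cons x l ih =>
    intro m u v h
    cases m with
    | nil =>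
      simp only [List.flatMap_cons, List.flatMap_nil, List.append_assoc, List.nil_append,
        List.cons_append] at h
      exact absurd h (hs _ _ _)
    | cons y m =>
      simp only [List.flatMap_cons, List.append_assoc] at h
      obtain ⟨h1, h2⟩ := hf _ _ _ _ h
      obtain ⟨h3, h4⟩ := ih m u v (by simpa using h2)
      exact ⟨by rw [h1, h3], h4⟩

theorem encodeInt_append_ne (z : ℤ) (u v : List LoopSym) :
    encodeInt z ++ u ≠ LoopSym.endRow :: v ∧ encodeInt z ++ u ≠ LoopSym.endSystem :: v := by
  unfold encodeInt
  by_cases hz : z < 0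
  · simp [hz]
  · rcases z.natAbs.bits with _ | ⟨d, s⟩
    · simp [hz]
    · cases d <;> simp [hz]

theorem encodeRow_append_inj (x y : List ℤ) (u v : List LoopSym)
    (h : encodeRow x ++ u = encodeRow y ++ v) : x = y ∧ u = v :=
  flatMap_append_inj encodeInt LoopSym.endRow (fun _ _ _ _ h => encodeInt_append_inj h)
    (fun z u v => (encodeInt_append_ne z u v).1) x y u v h

theorem encodeSystem_append_inj (x y : List (List ℤ)) (u v : List LoopSym)
    (h : encodeSystem x ++ u = encodeSystem y ++ v) : x = y ∧ u = v := by
  refine flatMap_append_inj encodeRow LoopSym.endSystem encodeRow_append_inj ?_ x y u v h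
  intro r u v h
  cases r with
  | nil => simp [encodeRow] at h
  | cons z r =>
    simp only [encodeRow, List.flatMap_cons, List.append_assoc] at h
    exact (encodeInt_append_ne z _ v).2 h

theorem SLCLoop.encode_injective : Function.Injective SLCLoop.encode := by
  intro l m h
  unfold SLCLoop.encode at h
  rw [List.append_assoc, List.append_assoc] at h
  obtain ⟨h1, h⟩ := encodeSystem_append_inj _ _ _ _ h
  obtain ⟨h2, h⟩ := encodeSystem_append_inj _ _ _ _ h
  obtain ⟨h3, -⟩ := encodeSystem_append_inj _ _ [] [] (by simpa using h)
  obtain ⟨n, r, p, q, hr, hp, hq, C, c, B, b, A, a⟩ := l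
  obtain ⟨n', r', p', q', hr', hp', hq', C', c', B', b', A', a'⟩ := m
  simp only [SLCLoop.preRows, SLCLoop.guardRows, SLCLoop.updateRows] at h1 h2 h3
  obtain rfl : r = r' := by simpa using congrArg List.length h1
  obtain rfl : p = p' := by simpa using congrArg List.length h2
  obtain rfl : q = q' := by simpa using congrArg List.length h3
  replace h1 := List.ofFn_injective h1
  replace h2 := List.ofFn_injective h2
  replace h3 := List.ofFn_injective h3
  obtain rfl : n = n' := by simpa using congrArg List.length (congrFun h1 ⟨0, hr⟩)
  have split : ∀ {k : ℕ} {f g : Fin k → ℤ} {s t : List ℤ},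
      List.ofFn f ++ s = List.ofFn g ++ t → f = g ∧ s = t := by
    intro k f g s t h
    obtain ⟨e1, e2⟩ := List.append_inj h (by simp)
    exact ⟨List.ofFn_injective e1, e2⟩
  obtain rfl : C = C' := by
    funext i; exact (split (congrFun h1 i)).1
  obtain rfl : c = c' := by
    funext i; simpa using (split (congrFun h1 i)).2
  obtain rfl : B = B' := by
    funext i; exact (split (congrFun h2 i)).1
  obtain rfl : b = b' := by
    funext i; simpa using (split (congrFun h2 i)).2
  have h3' : ∀ i, (fun j => A i (Sum.inl j)) = (fun j => A' i (Sum.inl j)) ∧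
      (fun j => A i (Sum.inr j)) = (fun j => A' i (Sum.inr j)) ∧ [a i] = [a' i] := by
    intro i
    have := congrFun h3 i
    simp only [List.append_assoc] at this
    exact ⟨(split this).1, split (split this).2⟩
  obtain rfl : A = A' := by
    funext i j
    rcases j with j | j
    · exact congrFun (h3' i).1 j
    · exact congrFun (h3' i).2.1 j
  obtain rfl : a = a' := by
    funext i; simpa using (h3' i).2.2
  rfl

/-! ### Polynomial space and PSPACE-hardness -/

open Classical in
/-- The language `L` of binary words is in PSPACE: it is decided by a deterministic Turing machine
(with finitely many stacks over finite alphabets, and a finite control) that on every input `w`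
never has more than `s(|w|)` symbols on any of its stacks, for a polynomial `s`. -/
def InPSPACE (L : Language Bool) : Prop :=
  ∃ M : Turing.TM2Computable (id : List Bool → List Bool) encodeBool (fun w => decide (w ∈ L)),
    (∀ k, Finite (M.tm.Γ k)) ∧
    ∃ s : Polynomial ℕ, ∀ (w : List Bool) (cfg : M.tm.Cfg),
      StateTransition.Reaches M.tm.step
        (Turing.initList M.tm (w.map M.inputAlphabet.invFun)) cfg →
      ∀ k, (cfg.stk k).length ≤ s.eval w.length

/-- The decision problem "given `x` with `Inst x`, does `Yes x` hold?", where the instances are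
represented by `enc`, is PSPACE-hard: every language in PSPACE has a polynomial-time many-one
reduction to it, all of whose values are instances. -/
def PSPACEHard {α Γ : Type} (enc : α → List Γ) (Inst Yes : α → Prop) : Prop :=
  ∀ L : Language Bool, InPSPACE L →
    ∃ f : List Bool → α,
      Nonempty (Turing.TM2ComputableInPolyTime (id : List Bool → List Bool) enc f) ∧
      ∀ w, Inst (f w) ∧ (w ∈ L ↔ Yes (f w))

open Turing StateTransition

/-! ### A structured language for stack machines -/

/-- Programs over stacks: `loop k body` pops symbols `a` from stack `k` and runs `body a`, until the
stack is empty. -/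
inductive StackProg {K : Type} (Γ : K → Type) : Type
  | skip
  | push (k : K) (a : Γ k)
  | seq (p q : StackProg Γ)
  | loop (k : K) (body : Γ k → StackProg Γ)

namespace StackProg

variable {K : Type} {Γ : K → Type}

/-- The lists of programs that can occur while `p` is run with the continuation `c`, except for `c`
itself. -/
def conts : StackProg Γ → List (StackProg Γ) → Set (List (StackProg Γ))
  | skip, c => {skip :: c}
  | push k a, c => {push k a :: c}
  | seq p q, c => {seq p q :: c} ∪ (conts p (q :: c) ∪ conts q c)
  | loop k b, c => {loop k b :: c} ∪ ⋃ a, conts (b a) (loop k b :: c)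

theorem cons_mem_conts (p : StackProg Γ) (c : List (StackProg Γ)) : p :: c ∈ conts p c := by
  cases p <;> simp [conts]

/-- Gives the compiled machine a finite control. Finite alphabets are needed because the body of a
loop may depend on the popped symbol. -/
theorem finite_conts [∀ k, Finite (Γ k)] (p : StackProg Γ) :
    ∀ c : List (StackProg Γ), (conts p c).Finite := by
  induction p with
  | skip => intro c; simp [conts]
  | push k a => intro c; simp [conts]
  | seq p q ihp ihq => intro c; exact (Set.finite_singleton _).union ((ihp _).union (ihq _))
  | loop k b ih => intro c; exact (Set.finite_singleton _).union (Set.finite_iUnion fun a => ih a _)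

/-- The continuation after one step; `o` is the symbol popped by a loop. -/
def nextCont : List (StackProg Γ) → (∀ k, Option (Γ k)) → List (StackProg Γ)
  | [], _ => []
  | skip :: c, _ => c
  | push _ _ :: c, _ => c
  | seq p q :: c, _ => p :: q :: c
  | loop k b :: c, o => (o k).elim c fun a => b a :: loop k b :: c

/-- A step either stays among the continuations of a subprogram or leaves that subprogram for the
continuation it was started with, which is again a continuation of `p` or is `c`. -/
theorem nextCont_mem_conts (p : StackProg Γ) : ∀ (c d : List (StackProg Γ)) (o : ∀ k, Option (Γ k)),
    d ∈ conts p c → nextCont d o ∈ conts p c ∪ {c} := by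
  induction p with
  | skip => rintro c d o rfl; simp [nextCont]
  | push k a => rintro c d o rfl; simp [nextCont]
  | seq p q ihp ihq =>
    rintro c d o (rfl | h | h)
    · exact .inl (.inr (.inl (cons_mem_conts p _)))
    · rcases ihp _ _ o h with h | h
      · exact .inl (.inr (.inl h))
      · rw [Set.mem_singleton_iff.1 h]
        exact .inl (.inr (.inr (cons_mem_conts q _)))
    · rcases ihq _ _ o h with h | h
      · exact .inl (.inr (.inr h))
      · exact .inr h
  | loop k b ih =>
    rintro c d o (rfl | h)
    · cases h : o k with
      | none => simp [nextCont, h]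
      | some a =>
        simp only [nextCont, h, Option.elim]
        exact .inl (.inr (Set.mem_iUnion.2 ⟨a, cons_mem_conts _ _⟩))
    · obtain ⟨a, h⟩ := Set.mem_iUnion.1 h
      rcases ih a _ _ o h with h | h
      · exact .inl (.inr (Set.mem_iUnion.2 ⟨a, h⟩))
      · rw [Set.mem_singleton_iff.1 h]
        exact .inl (cons_mem_conts _ _)

/-- The labels of the machine for `p`. -/
def Label (p : StackProg Γ) : Type := ↥(conts p [] ∪ {[]})

instance [∀ k, Finite (Γ k)] (p : StackProg Γ) : Finite p.Label :=
  ((finite_conts p []).union (Set.finite_singleton _)).to_subtype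

theorem nextCont_mem (p : StackProg Γ) (d : p.Label) (o : ∀ k, Option (Γ k)) :
    nextCont d.1 o ∈ conts p [] ∪ {[]} := by
  rcases d with ⟨d, h | h⟩
  · exact nextCont_mem_conts p _ _ o h
  · obtain rfl : d = [] := h
    exact .inr rfl

variable [DecidableEq K]

/-- One step of the evaluation of a list of programs. -/
def contStep : List (StackProg Γ) × (∀ k, List (Γ k)) →
    Option (List (StackProg Γ) × (∀ k, List (Γ k)))
  | ([], _) => none
  | (skip :: c, S) => some (c, S)
  | (push k a :: c, S) => some (c, Function.update S k (a :: S k))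
  | (seq p q :: c, S) => some (p :: q :: c, S)
  | (loop k b :: c, S) =>
    some ((S k).head?.elim c fun a => b a :: loop k b :: c, Function.update S k (S k).tail)

/-- The program `p` turns the stacks `S` into `S'` in at most `t` steps. -/
def Does (p : StackProg Γ) (S S' : ∀ k, List (Γ k)) (t : ℕ) : Prop :=
  ∀ c, ∃ t' ≤ t, (flip bind contStep)^[t'] (some (p :: c, S)) = some (c, S')

theorem Does.mono {p : StackProg Γ} {S S' : ∀ k, List (Γ k)} {t u : ℕ} (h : Does p S S' t)
    (htu : t ≤ u) : Does p S S' u := fun c =>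
  let ⟨t', h1, h2⟩ := h c
  ⟨t', h1.trans htu, h2⟩

theorem does_skip (S : ∀ k, List (Γ k)) : Does skip S S 1 := fun _ => ⟨1, le_rfl, rfl⟩

theorem does_push (S : ∀ k, List (Γ k)) (k : K) (a : Γ k) :
    Does (push k a) S (Function.update S k (a :: S k)) 1 := fun _ => ⟨1, le_rfl, rfl⟩

theorem Does.seq {p q : StackProg Γ} {S S' S'' : ∀ k, List (Γ k)} {t u : ℕ} (hp : Does p S S' t)
    (hq : Does q S' S'' u) : Does (seq p q) S S'' (t + u + 1) := by
  intro c
  obtain ⟨t', ht, h1⟩ := hp (q :: c)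
  obtain ⟨u', hu, h2⟩ := hq c
  refine ⟨u' + t' + 1, by omega, ?_⟩
  rw [Function.iterate_succ_apply, Function.iterate_add_apply]
  change (flip bind contStep)^[u'] ((flip bind contStep)^[t'] (some (p :: q :: c, S))) = _
  rw [h1, h2]

theorem does_loop_nil {S : ∀ k, List (Γ k)} {k : K} (b : Γ k → StackProg Γ) (h : S k = []) :
    Does (loop k b) S S 1 := by
  intro c
  refine ⟨1, le_rfl, ?_⟩
  have : Function.update S k (S k).tail = S := by rw [h, List.tail_nil, ← h, Function.update_eq_self]
  change contStep (loop k b :: c, S) = _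
  rw [contStep, this, h]
  rfl

theorem does_loop_cons {S S' S'' : ∀ k, List (Γ k)} {k : K} {b : Γ k → StackProg Γ} {a : Γ k}
    {l : List (Γ k)} {t u : ℕ} (h : S k = a :: l) (h1 : Does (b a) (Function.update S k l) S' t)
    (h2 : Does (loop k b) S' S'' u) : Does (loop k b) S S'' (t + u + 1) := by
  intro c
  obtain ⟨t', ht, h1⟩ := h1 (loop k b :: c)
  obtain ⟨u', hu, h2⟩ := h2 c
  refine ⟨u' + t' + 1, by omega, ?_⟩
  rw [Function.iterate_succ_apply, Function.iterate_add_apply]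
  have : flip bind contStep (some (loop k b :: c, S)) =
      some (b a :: loop k b :: c, Function.update S k l) := by
    simp [flip, contStep, h]
  rw [this, h1, h2]

/-! ### Compilation to a Turing machine -/

/-- The symbol in the memory of the machine, if it is from stack `k`. -/
def popped (v : Option (Σ k, Γ k)) (k : K) : Option (Γ k) :=
  v.elim none fun a => if h : a.1 = k then some (h ▸ a.2) else none

/-- The code of the machine for `p`. -/
def code (p : StackProg Γ) (d : p.Label) : TM2.Stmt Γ p.Label (Option (Σ k, Γ k)) :=
  let next : TM2.Stmt Γ p.Label (Option (Σ k, Γ k)) :=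
    .goto fun v => ⟨nextCont d.1 (popped v), nextCont_mem p d _⟩
  match d.1 with
  -- `haltList` requires the memory to be back in its initial state.
  | [] => .load (fun _ => none) .halt
  | skip :: _ => next
  | push k a :: _ => .push k (fun _ => a) next
  | seq _ _ :: _ => next
  -- The popped symbol goes to the memory, where the following `goto` reads it. For an empty stack
  -- the memory becomes `none`, which ends the loop.
  | loop k _ :: _ => .pop k (fun _ o => o.map (Sigma.mk k)) next

/-- The machine for `p`. -/
noncomputable def machine [Fintype K] [∀ k, Finite (Γ k)] (p : StackProg Γ) (k₀ k₁ : K) : FinTM2 :=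
  letI := Fintype.ofFinite p.Label
  letI := Fintype.ofFinite (Γ k₀)
  letI := Fintype.ofFinite (Option (Σ k, Γ k))
  { k₀ := k₀
    k₁ := k₁
    Γ := Γ
    Λ := p.Label
    main := ⟨[p], .inl (cons_mem_conts p [])⟩
    σ := Option (Σ k, Γ k)
    initialState := none
    m := code p }

theorem popped_map (k : K) (o : Option (Γ k)) : popped (o.map (Sigma.mk k)) k = o := by
  cases o <;> simp [popped]

/-- The old memory `v` may be stale, but only a loop consults it, and a loop overwrites it by its
pop first. -/
theorem step_code (p : StackProg Γ) (d : p.Label) (v : Option (Σ k, Γ k)) (S : ∀ k, List (Γ k))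
    (x : List (StackProg Γ) × (∀ k, List (Γ k))) (hx : contStep (d.1, S) = some x) :
    ∃ (d' : p.Label) (v' : Option (Σ k, Γ k)), d'.1 = x.1 ∧
      TM2.step (code p) ⟨some d, v, S⟩ = some ⟨some d', v', x.2⟩ := by
  rcases d with ⟨_ | ⟨q, c⟩, hd⟩
  · simp [contStep] at hx
  · cases q <;>
      · simp only [contStep, Option.some.injEq] at hx
        subst hx
        refine ⟨_, _, ?_, rfl⟩
        simp [nextCont, popped_map]

theorem iterate_step_code (p : StackProg Γ) (t : ℕ) :
    ∀ (d : p.Label) (v : Option (Σ k, Γ k)) (S : ∀ k, List (Γ k))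
      (x : List (StackProg Γ) × (∀ k, List (Γ k))),
      (flip bind contStep)^[t] (some (d.1, S)) = some x →
      ∃ (d' : p.Label) (v' : Option (Σ k, Γ k)), d'.1 = x.1 ∧
        (flip bind (TM2.step (code p)))^[t] (some ⟨some d, v, S⟩) = some ⟨some d', v', x.2⟩ := by
  induction t with
  | zero => rintro d v S x h; cases h; exact ⟨d, v, rfl, rfl⟩
  | succ t ih =>
    intro d v S x h
    rw [Function.iterate_succ_apply] at h
    change (flip bind contStep)^[t] (contStep (d.1, S)) = _ at h
    have none_iter : ∀ t, (flip bind (contStep (Γ := Γ)))^[t] none = none := by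
      intro t
      induction t with
      | zero => rfl
      | succ t ih => rw [Function.iterate_succ_apply]; exact ih
    cases hy : contStep (d.1, S) with
    | none => rw [hy, none_iter] at h; cases h
    | some y =>
      obtain ⟨d', v', h1, h2⟩ := step_code p d v S y hy
      rw [hy] at h
      obtain ⟨d'', v'', h3, h4⟩ := ih d' v' y.2 x (by rw [h1]; exact h)
      refine ⟨d'', v'', h3, ?_⟩
      rw [Function.iterate_succ_apply]
      change (flip bind (TM2.step (code p)))^[t] (TM2.step (code p) ⟨some d, v, S⟩) = _
      rw [h2, h4]

/-- The left side is the form in which `initList` and `haltList` give their stacks. -/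
theorem dite_cast_eq_update (k₀ k : K) (l : List (Γ k₀)) :
    (if h : k = k₀ then (by rw [h]; exact l : List (Γ k)) else []) =
      Function.update (fun _ => []) k₀ l k := by
  by_cases h : k = k₀
  · subst h; simp
  · simp [h]

/-- If `p` turns the input stack into the output stack, in polynomial time, then the function it
computes is polynomial-time computable. -/
theorem computable [Fintype K] [∀ k, Finite (Γ k)] {α β : Type} {f : α → β}
    (p : StackProg Γ) (time : Polynomial ℕ) {k₀ k₁ : K} {ea : α → List (Γ k₀)}
    {eb : β → List (Γ k₁)}
    (h : ∀ a, Does p (Function.update (fun _ => []) k₀ (ea a))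
      (Function.update (fun _ => []) k₁ (eb (f a))) (time.eval (ea a).length)) :
    Nonempty (TM2ComputableInPolyTime ea eb f) := by
  have key : ∀ a, ∃ n ≤ time.eval (ea a).length + 1,
      (flip bind (machine p k₀ k₁).step)^[n] (some (initList (machine p k₀ k₁) (ea a))) =
        some (haltList (machine p k₀ k₁) (eb (f a))) := by
    intro a
    obtain ⟨t, ht, h1⟩ := h a []
    obtain ⟨⟨d, hd⟩, v, h2, h3⟩ := iterate_step_code p t ⟨[p], .inl (cons_mem_conts p [])⟩ none _ _ h1
    obtain rfl : d = [] := h2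
    -- The additional step is the one at the empty continuation, which clears the memory and halts.
    refine ⟨t + 1, by omega, ?_⟩
    rw [Function.iterate_succ_apply']
    have init : initList (machine p k₀ k₁) (ea a) =
        ⟨some ⟨[p], .inl (cons_mem_conts p [])⟩, none, Function.update (fun _ => []) k₀ (ea a)⟩ := by
      unfold initList
      congr 1
      funext k
      exact dite_cast_eq_update k₀ k _
    have fin : haltList (machine p k₀ k₁) (eb (f a)) =
        ⟨none, none, Function.update (fun _ => []) k₁ (eb (f a))⟩ := by
      unfold haltList
      congr 1
      funext k
      exact dite_cast_eq_update k₁ k _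
    rw [init, fin]
    refine (congrArg (flip bind (TM2.step (code p))) h3).trans ?_
    rfl
  choose n hn h1 using key
  exact ⟨{
    tm := machine p k₀ k₁
    inputAlphabet := Equiv.refl _
    outputAlphabet := Equiv.refl _
    time := time + 1
    outputsFun := fun a =>
      { steps := n a
        evals_in_steps := by
          have e1 : (ea a).map (Equiv.refl (Γ k₀)).invFun = ea a := List.map_id _
          have e2 : (eb (f a)).map (Equiv.refl (Γ k₁)).invFun = eb (f a) := List.map_id _
          exact (congrArg (fun l => (flip bind (machine p k₀ k₁).step)^[n a]
            (some (initList (machine p k₀ k₁) l))) e1).trans ((h1 a).trans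
            (congrArg (fun l => some (haltList (machine p k₀ k₁) l)) e2).symm)
        steps_le_m := by simpa using hn a } }⟩

end StackProg

/-! ### Sequences of programs and an invariant rule for loops -/

namespace StackProg

section

variable {K : Type} {Γ : K → Type}

/-- Run the programs of a list one after the other. -/
def seqList (l : List (StackProg Γ)) : StackProg Γ := l.foldr seq skip

variable [DecidableEq K]

/-- An invariant `σ` for a loop: `σ d r` are the stacks when the symbols `d` have been popped, the
last one first, and `r` remains. -/
theorem does_loop {k : K} {b : Γ k → StackProg Γ}
    (σ : List (Γ k) → List (Γ k) → ∀ k, List (Γ k)) (l : List (Γ k)) (t : ℕ)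
    (hk : ∀ d r, σ d r k = r)
    (h : ∀ d a r, d.reverse ++ a :: r = l →
      Does (b a) (Function.update (σ d (a :: r)) k r) (σ (a :: d) r) t) :
    Does (loop k b) (σ [] l) (σ l.reverse []) (l.length * (t + 1) + 1) := by
  have key : ∀ r d, d.reverse ++ r = l →
      Does (loop k b) (σ d r) (σ l.reverse []) (r.length * (t + 1) + 1) := by
    intro r
    induction r with
    | nil =>
      intro d hd
      obtain rfl : d = l.reverse := by rw [← hd]; simp
      exact (does_loop_nil b (hk _ _)).mono (by simp)
    | cons a r ih =>
      intro d hd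
      refine (does_loop_cons (hk _ _) (h d a r hd) (ih (a :: d) (by simp [← hd]))).mono ?_
      rw [List.length_cons]
      nlinarith
  exact key l [] rfl

theorem Does.cast {p : StackProg Γ} {S S' T T' : ∀ k, List (Γ k)} {t u : ℕ} (h : Does p S S' t)
    (hS : T = S) (hT : T' = S') (htu : t ≤ u) : Does p T T' u := by
  subst hS hT
  exact h.mono htu

end

end StackProg

open StackProg

/-! ### Windowed systems of constraints -/

/-- The positions of a word of positions, which carry the symbols of an input word. -/
inductive Pos
  | start | bit (b : Bool) | blank | last
  deriving Fintype

/-- A row with a window: a list of pieces, each consisting of coefficients that stay in place and of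
coefficients in the window, and a right-hand side. -/
abbrev Template : Type := List (List ℤ × List ℤ) × ℤ

/-- A piece of a template, with the window preceded by `i` and followed by `j` blocks of `m`
zeros. -/
def widen (m i j : ℕ) (p : List ℤ × List ℤ) : List ℤ :=
  p.1 ++ List.replicate (i * m) 0 ++ p.2 ++ List.replicate (j * m) 0

/-- The row of a template at a position with `i` positions before it and `j` after it. -/
def templateRow (m i j : ℕ) (R : Template) : List ℤ :=
  R.1.flatMap (widen m i j) ++ [R.2]

/-- The rows of the templates `T` at all positions of a word, after `i` other positions. -/
def windowRows (m : ℕ) (T : Pos → List Template) : ℕ → List Pos → List (List ℤ)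
  | _, [] => []
  | i, a :: l => (T a).map (templateRow m i l.length) ++ windowRows m T (i + 1) l

/-! ### A program that writes windowed systems -/

/-- The stacks of the program. -/
inductive Stk
  | inp | cnt | fst | snd | todo | done | aux | txt | out
  deriving DecidableEq

instance : Fintype Stk :=
  ⟨{.inp, .cnt, .fst, .snd, .todo, .done, .aux, .txt, .out}, fun k => by cases k <;> simp⟩

/-- The alphabets of the stacks. -/
abbrev Alph : Stk → Type
  | .inp => Bool
  | .cnt | .fst | .snd => Unit
  | .todo | .done | .aux => Pos
  | .txt | .out => LoopSym

instance : Finite LoopSym :=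
  Finite.of_surjective (fun i : Fin 6 => match i with
    | 0 => LoopSym.zero | 1 => .one | 2 => .minus | 3 => .endNum | 4 => .endRow | 5 => .endSystem)
    fun s => by
      cases s
      exacts [⟨0, rfl⟩, ⟨1, rfl⟩, ⟨2, rfl⟩, ⟨3, rfl⟩, ⟨4, rfl⟩, ⟨5, rfl⟩]

instance : ∀ k, Finite (Alph k)
  | .inp => inferInstanceAs (Finite Bool)
  | .cnt | .fst | .snd => inferInstanceAs (Finite Unit)
  | .todo | .done | .aux => inferInstanceAs (Finite Pos)
  | .txt | .out => inferInstanceAs (Finite LoopSym)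

/-- The stacks with the given contents. -/
def stackFill (inp : List Bool) (cnt fst snd : List Unit) (todo done aux : List Pos)
    (txt out : List LoopSym) : ∀ k, List (Alph k)
  | .inp => inp
  | .cnt => cnt
  | .fst => fst
  | .snd => snd
  | .todo => todo
  | .done => done
  | .aux => aux
  | .txt => txt
  | .out => out

section

variable (inp : List Bool) (cnt fst snd : List Unit) (todo done aux : List Pos)
  (txt out : List LoopSym)

/-- These rules keep all stack contents in the normal form `stackFill`, so that running a program
amounts to changing single arguments. -/
theorem update_inp (l : List Bool) :
    Function.update (stackFill inp cnt fst snd todo done aux txt out) .inp l =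
      stackFill l cnt fst snd todo done aux txt out := by
  funext k; cases k <;> rfl

theorem update_cnt (l : List Unit) :
    Function.update (stackFill inp cnt fst snd todo done aux txt out) .cnt l =
      stackFill inp l fst snd todo done aux txt out := by
  funext k; cases k <;> rfl

theorem update_fst (l : List Unit) :
    Function.update (stackFill inp cnt fst snd todo done aux txt out) .fst l =
      stackFill inp cnt l snd todo done aux txt out := by
  funext k; cases k <;> rfl

theorem update_snd (l : List Unit) :
    Function.update (stackFill inp cnt fst snd todo done aux txt out) .snd l =
      stackFill inp cnt fst l todo done aux txt out := by
  funext k; cases k <;> rfl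

theorem update_todo (l : List Pos) :
    Function.update (stackFill inp cnt fst snd todo done aux txt out) .todo l =
      stackFill inp cnt fst snd l done aux txt out := by
  funext k; cases k <;> rfl

theorem update_done (l : List Pos) :
    Function.update (stackFill inp cnt fst snd todo done aux txt out) .done l =
      stackFill inp cnt fst snd todo l aux txt out := by
  funext k; cases k <;> rfl

theorem update_aux (l : List Pos) :
    Function.update (stackFill inp cnt fst snd todo done aux txt out) .aux l =
      stackFill inp cnt fst snd todo done l txt out := by
  funext k; cases k <;> rfl

theorem update_txt (l : List LoopSym) :
    Function.update (stackFill inp cnt fst snd todo done aux txt out) .txt l =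
      stackFill inp cnt fst snd todo done aux l out := by
  funext k; cases k <;> rfl

theorem update_out (l : List LoopSym) :
    Function.update (stackFill inp cnt fst snd todo done aux txt out) .out l =
      stackFill inp cnt fst snd todo done aux txt l := by
  funext k; cases k <;> rfl

theorem push_cnt (a : Unit) : Does (push .cnt a : StackProg Alph)
    (stackFill inp cnt fst snd todo done aux txt out)
    (stackFill inp (a :: cnt) fst snd todo done aux txt out) 1 :=
  (does_push _ Stk.cnt a).cast rfl (update_cnt _ _ _ _ _ _ _ _ _ _).symm le_rfl

theorem push_fst (a : Unit) : Does (push .fst a : StackProg Alph)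
    (stackFill inp cnt fst snd todo done aux txt out)
    (stackFill inp cnt (a :: fst) snd todo done aux txt out) 1 :=
  (does_push _ Stk.fst a).cast rfl (update_fst _ _ _ _ _ _ _ _ _ _).symm le_rfl

theorem push_snd (a : Unit) : Does (push .snd a : StackProg Alph)
    (stackFill inp cnt fst snd todo done aux txt out)
    (stackFill inp cnt fst (a :: snd) todo done aux txt out) 1 :=
  (does_push _ Stk.snd a).cast rfl (update_snd _ _ _ _ _ _ _ _ _ _).symm le_rfl

theorem push_todo (a : Pos) : Does (push .todo a : StackProg Alph)
    (stackFill inp cnt fst snd todo done aux txt out)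
    (stackFill inp cnt fst snd (a :: todo) done aux txt out) 1 :=
  (does_push _ Stk.todo a).cast rfl (update_todo _ _ _ _ _ _ _ _ _ _).symm le_rfl

theorem push_done (a : Pos) : Does (push .done a : StackProg Alph)
    (stackFill inp cnt fst snd todo done aux txt out)
    (stackFill inp cnt fst snd todo (a :: done) aux txt out) 1 :=
  (does_push _ Stk.done a).cast rfl (update_done _ _ _ _ _ _ _ _ _ _).symm le_rfl

theorem push_aux (a : Pos) : Does (push .aux a : StackProg Alph)
    (stackFill inp cnt fst snd todo done aux txt out)
    (stackFill inp cnt fst snd todo done (a :: aux) txt out) 1 :=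
  (does_push _ Stk.aux a).cast rfl (update_aux _ _ _ _ _ _ _ _ _ _).symm le_rfl

theorem push_txt (a : LoopSym) : Does (push .txt a : StackProg Alph)
    (stackFill inp cnt fst snd todo done aux txt out)
    (stackFill inp cnt fst snd todo done aux (a :: txt) out) 1 :=
  (does_push _ Stk.txt a).cast rfl (update_txt _ _ _ _ _ _ _ _ _ _).symm le_rfl

theorem push_out (a : LoopSym) : Does (push .out a : StackProg Alph)
    (stackFill inp cnt fst snd todo done aux txt out)
    (stackFill inp cnt fst snd todo done aux txt (a :: out)) 1 :=
  (does_push _ Stk.out a).cast rfl (update_out _ _ _ _ _ _ _ _ _ _).symm le_rfl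

end

/-- The stacks while the text is written. -/
abbrev writing (todo done : List Pos) (txt : List LoopSym) : ∀ k, List (Alph k) :=
  stackFill [] [] [] [] todo done [] txt []

/-- The program `p` appends a text to the stack `txt`, in time linear in the number of
positions. -/
def Prints (p : StackProg Alph) (text : List Pos → List Pos → List LoopSym) : Prop :=
  ∃ c, ∀ todo done txt, Does p (writing todo done txt)
    (writing todo done ((text todo done).reverse ++ txt)) (c * (todo.length + done.length + 1))

theorem Prints.seq {p q : StackProg Alph} {f g : List Pos → List Pos → List LoopSym}
    (hp : Prints p f) (hq : Prints q g) : Prints (seq p q) fun l d => f l d ++ g l d := by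
  obtain ⟨c, hp⟩ := hp
  obtain ⟨c', hq⟩ := hq
  refine ⟨c + c' + 1, fun l d txt => ((hp l d txt).seq (hq l d _)).cast rfl (by simp) ?_⟩
  nlinarith

theorem prints_skip : Prints skip fun _ _ => [] :=
  ⟨1, fun l d _ => (does_skip _).mono (by omega)⟩

theorem Prints.seqList {ι : Type} {p : ι → StackProg Alph}
    {f : ι → List Pos → List Pos → List LoopSym} (h : ∀ i, Prints (p i) (f i)) (l : List ι) :
    Prints (StackProg.seqList (l.map p)) fun r d => l.flatMap fun i => f i r d := by
  induction l with
  | nil => exact prints_skip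
  | cons i l ih => exact (h i).seq ih

/-- Write a fixed text. -/
def printText (s : List LoopSym) : StackProg Alph := StackProg.seqList (s.map fun a : LoopSym => push .txt a)

theorem prints_printText (s : List LoopSym) : Prints (printText s) fun _ _ => s := by
  have := Prints.seqList (p := fun a => push Stk.txt a) (f := fun a _ _ => [a])
    (fun a => ⟨1, fun l d txt => (push_txt _ _ _ _ _ _ _ _ _ a).mono (by omega)⟩) s
  simpa [printText] using this

/-- Run a program once for every position that is done. -/
def forDone (p : StackProg Alph) : StackProg Alph :=
  .seq (loop .done fun a : Pos => .seq p (push .aux a)) (loop .aux fun a : Pos => push .done a)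

/-- Run a program once for every position that remains. -/
def forTodo (p : StackProg Alph) : StackProg Alph :=
  .seq (loop .todo fun a : Pos => .seq p (push .aux a)) (loop .aux fun a : Pos => push .todo a)

/-- Unlike `Prints`, this allows a nonempty `aux`, which occurs inside `forDone` and `forTodo`. -/
theorem printText_does (s : List LoopSym) (todo done aux : List Pos) (txt : List LoopSym) :
    Does (printText s) (stackFill [] [] [] [] todo done aux txt [])
      (stackFill [] [] [] [] todo done aux (s.reverse ++ txt) []) (2 * s.length + 1) := by
  induction s generalizing txt with
  | nil => exact does_skip _
  | cons a s ih =>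
    exact ((push_txt _ _ _ _ _ _ _ _ _ a).seq (ih (a :: txt))).cast rfl (by simp)
      (by rw [List.length_cons]; omega)

/-- The first loop moves `done` to `aux` and writes `m` symbols for each position; the second loop
moves everything back, so `done` serves as a counter that survives. -/
theorem prints_forDone (s : LoopSym) (m : ℕ) :
    Prints (forDone (printText (List.replicate m s))) fun _ d => List.replicate (d.length * m) s := by
  refine ⟨2 * m + 20, fun l d txt => ?_⟩
  have h1 := does_loop (k := Stk.done)
    (b := fun a : Pos => .seq (printText (List.replicate m s)) (push .aux a))
    (fun x r => stackFill [] [] [] [] l r x (List.replicate (x.length * m) s ++ txt) []) d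
    (2 * m + 1 + 1 + 1) (fun _ _ => rfl) (fun x a r _ => by
      rw [update_done]
      refine ((printText_does _ _ _ _ _).seq (push_aux _ _ _ _ _ _ _ _ _ a)).cast rfl ?_ (by simp)
      congr 1
      rw [List.reverse_replicate, ← List.append_assoc, List.replicate_append_replicate,
        List.length_cons]
      congr 2
      ring)
  have h2 := does_loop (k := Stk.aux) (b := fun a : Pos => push .done a)
    (fun x r => stackFill [] [] [] [] l x r (List.replicate (d.length * m) s ++ txt) []) d.reverse
    1 (fun _ _ => rfl) (fun x a r _ => by
      rw [update_aux]
      exact push_done _ _ _ _ _ _ _ _ _ a)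
  rw [List.length_reverse, List.reverse_reverse] at h2
  refine (h1.seq (h2.cast ?_ rfl le_rfl)).cast ?_ ?_ ?_
  · simp
  · simp
  · simp
  · nlinarith

theorem prints_forTodo (s : LoopSym) (m : ℕ) :
    Prints (forTodo (printText (List.replicate m s))) fun l _ => List.replicate (l.length * m) s := by
  refine ⟨2 * m + 20, fun l d txt => ?_⟩
  have h1 := does_loop (k := Stk.todo)
    (b := fun a : Pos => .seq (printText (List.replicate m s)) (push .aux a))
    (fun x r => stackFill [] [] [] [] r d x (List.replicate (x.length * m) s ++ txt) []) l
    (2 * m + 1 + 1 + 1) (fun _ _ => rfl) (fun x a r _ => by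
      rw [update_todo]
      refine ((printText_does _ _ _ _ _).seq (push_aux _ _ _ _ _ _ _ _ _ a)).cast rfl ?_ (by simp)
      congr 1
      rw [List.reverse_replicate, ← List.append_assoc, List.replicate_append_replicate,
        List.length_cons]
      congr 2
      ring)
  have h2 := does_loop (k := Stk.aux) (b := fun a : Pos => push .todo a)
    (fun x r => stackFill [] [] [] [] x d r (List.replicate (l.length * m) s ++ txt) []) l.reverse
    1 (fun _ _ => rfl) (fun x a r _ => by
      rw [update_aux]
      exact push_todo _ _ _ _ _ _ _ _ _ a)
  rw [List.length_reverse, List.reverse_reverse] at h2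
  refine (h1.seq (h2.cast ?_ rfl le_rfl)).cast ?_ ?_ ?_
  · simp
  · simp
  · simp
  · nlinarith

/-- Zero has no binary digits, so its code is a bare end marker and zero padding is a run of one
symbol. -/
theorem flatMap_encodeInt_replicate (n : ℕ) :
    (List.replicate n (0 : ℤ)).flatMap encodeInt = List.replicate n LoopSym.endNum := by
  induction n with
  | zero => rfl
  | succ n ih => rw [List.replicate_succ, List.flatMap_cons, ih]; rfl

/-- Write a piece of a template at the current position. -/
def printPiece (m : ℕ) (p : List ℤ × List ℤ) : StackProg Alph :=
  .seq (printText (p.1.flatMap encodeInt)) <|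
  .seq (forDone (printText (List.replicate m .endNum))) <|
  .seq (printText (p.2.flatMap encodeInt)) <|
  forTodo (printText (List.replicate m .endNum))

theorem prints_printPiece (m : ℕ) (p : List ℤ × List ℤ) :
    Prints (printPiece m p) fun l d => (widen m d.length l.length p).flatMap encodeInt := by
  have := (prints_printText (p.1.flatMap encodeInt)).seq
    ((prints_forDone .endNum m).seq ((prints_printText (p.2.flatMap encodeInt)).seq
      (prints_forTodo .endNum m)))
  simpa [printPiece, widen, List.flatMap_append, flatMap_encodeInt_replicate] using this

/-- Write a row at the current position. -/
def printRow (m : ℕ) (R : Template) : StackProg Alph :=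
  .seq (StackProg.seqList (R.1.map (printPiece m))) (printText (encodeInt R.2 ++ [.endRow]))

theorem prints_printRow (m : ℕ) (R : Template) :
    Prints (printRow m R) fun l d => encodeRow (templateRow m d.length l.length R) := by
  have := (Prints.seqList (prints_printPiece m) R.1).seq
    (prints_printText (encodeInt R.2 ++ [.endRow]))
  simpa [printRow, encodeRow, templateRow, List.flatMap_append, List.flatMap_assoc] using this

/-- Write the windowed system of the templates `T`. -/
def printSystem (m : ℕ) (T : Pos → List Template) : StackProg Alph :=
  .seq (loop .todo fun a : Pos =>
    .seq (StackProg.seqList ((T a).map (printRow m))) (push .done a)) <|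
  .seq (loop .done fun a : Pos => push .todo a) (printText [.endSystem])

/-- While a position is processed, `done` and `todo` contain the positions before and after it;
their lengths are the two amounts of padding. Each position costs linear time, so the total is
quadratic. -/
theorem exists_does_printSystem (m : ℕ) (T : Pos → List Template) :
    ∃ c, ∀ l txt, Does (printSystem m T) (writing l [] txt)
      (writing l [] ((encodeSystem (windowRows m T 0 l)).reverse ++ txt))
      (c * (l.length + 1) ^ 2) := by
  have h := fun a => Prints.seqList (prints_printRow m) (T a)
  choose c hc using h
  -- There are finitely many position symbols, so the sum of their constants serves for all.
  have hle : ∀ a, c a ≤ ∑ a, c a := fun a => Finset.single_le_sum (fun _ _ => Nat.zero_le _)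
    (Finset.mem_univ a)
  refine ⟨∑ a, c a + 20, fun l txt => ?_⟩
  generalize hC : ∑ a, c a = C at *
  have key : ∀ r d txt, r.length + d.length = l.length →
      Does (loop .todo fun a : Pos =>
        .seq (StackProg.seqList ((T a).map (printRow m))) (push .done a)) (writing r d txt)
        (writing [] (r.reverse ++ d)
          (((windowRows m T d.length r).flatMap encodeRow).reverse ++ txt))
        (r.length * (C * (l.length + 1) + 3) + 1) := by
    intro r
    induction r with
    | nil => intro d txt _; exact (does_loop_nil _ rfl).cast rfl rfl (by simp)
    | cons a r ih =>
      intro d txt hd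
      rw [List.length_cons] at hd
      have h1 := (hc a r d txt).seq (push_done [] [] [] [] r d [] _ [] a)
      have h2 := ih (a :: d) (((T a).flatMap fun R =>
        encodeRow (templateRow m d.length r.length R)).reverse ++ txt) (by simp; omega)
      refine (does_loop_cons (S := writing (a :: r) d txt) (k := Stk.todo) (a := a) (l := r) rfl
        (h1.cast (update_todo _ _ _ _ _ _ _ _ _ _) rfl le_rfl) h2).cast rfl ?_ ?_
      · simp [windowRows, List.flatMap_append, List.flatMap_map]
      · rw [List.length_cons]
        have : c a * (r.length + d.length + 1) ≤ C * (l.length + 1) :=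
          Nat.mul_le_mul (hle a) (by omega)
        nlinarith
  have h2 := does_loop (k := Stk.done) (b := fun a : Pos => push .todo a)
    (fun x r => writing x r (((windowRows m T 0 l).flatMap encodeRow).reverse ++ txt)) l.reverse
    1 (fun _ _ => rfl) (fun x a r _ => by
      rw [update_done]
      exact push_todo _ _ _ _ _ _ _ _ _ a)
  rw [List.length_reverse, List.reverse_reverse] at h2
  refine ((key l [] txt rfl).seq ((h2.cast (by simp) rfl le_rfl).seq
    (printText_does [.endSystem] _ _ _ _))).cast rfl ?_ ?_
  · simp [encodeSystem]
  · simp only [List.length_cons, List.length_nil]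
    nlinarith [Nat.zero_le C, Nat.zero_le l.length, Nat.zero_le (C * l.length)]

open StackProg

/-! ### A program that writes loops -/

/-- The word of positions for the input word `w`, with `x` blanks. -/
def posWord (w : List Bool) (x : ℕ) : List Pos :=
  .start :: (w.map .bit ++ (List.replicate x .blank ++ [.last]))

theorem length_posWord (w : List Bool) (x : ℕ) : (posWord w x).length = w.length + x + 2 := by
  simp [posWord]; omega

/-- Read the input and count its symbols. -/
def readInput : StackProg Alph :=
  loop .inp fun b : Bool => .seq (push .done (.bit b)) (push .cnt ())

theorem unit_list_ext {l l' : List Unit} (h : l.length = l'.length) : l = l' :=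
  List.ext_getElem h fun _ _ _ => rfl

theorem readInput_does (w : List Bool) :
    Does readInput (stackFill w [] [] [] [] [] [] [] [])
      (stackFill [] (List.replicate w.length ()) [] [] [] (w.reverse.map .bit) [] [] [])
      (w.length * 4 + 1) := by
  have h := does_loop (k := Stk.inp) (b := fun b : Bool => .seq (push .done (.bit b)) (push .cnt ()))
    (fun d r => stackFill r (d.map fun _ => ()) [] [] [] (d.map .bit) [] [] []) w 3
    (fun _ _ => rfl) (fun d a r _ => by
      rw [update_inp]
      exact (push_done _ _ _ _ _ _ _ _ _ (.bit a)).seq (push_cnt _ _ _ _ _ _ _ _ _ ()))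
  exact h.cast rfl (by congr 1; exact unit_list_ext (by simp)) le_rfl

/-- Multiply the number on `fst` by the successor of the number on `cnt`. -/
def mulCount : StackProg Alph :=
  .seq (loop .fst fun _ : Unit => .seq (push .snd ()) <|
    .seq (loop .cnt fun _ : Unit => .seq (push .aux .blank) (push .snd ()))
      (loop .aux fun _ : Pos => push .cnt ()))
  (loop .snd fun _ : Unit => push .fst ())

/-- Each unit of `fst` contributes one unit directly and one per unit of `cnt`, that is `n + 1`;
`aux` remembers `cnt` meanwhile. -/
theorem mulCount_does (n x : ℕ) (D : List Pos) :
    Does mulCount (stackFill [] (List.replicate n ()) (List.replicate x ()) [] [] D [] [] [])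
      (stackFill [] (List.replicate n ()) (List.replicate (x * (n + 1)) ()) [] [] D [] [] [])
      (20 * (x + 1) * (n + 1)) := by
  have h1 : ∀ s f, Does (loop .cnt fun _ : Unit => .seq (push .aux .blank) (push .snd ()))
      (stackFill [] (List.replicate n ()) f s [] D [] [] [])
      (stackFill [] [] f (List.replicate n () ++ s) [] D (List.replicate n .blank) [] [])
      (n * 4 + 1) := by
    intro s f
    have h := does_loop (k := Stk.cnt)
      (b := fun _ : Unit => .seq (push .aux .blank) (push .snd ()))
      (fun d r => stackFill [] r f (d ++ s) [] D (List.replicate d.length .blank) [] [])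
      (List.replicate n ()) 3
      (fun _ _ => rfl) (fun d a r _ => by
        rw [update_cnt]
        exact (push_aux _ _ _ _ _ _ _ _ _ .blank).seq (push_snd _ _ _ _ _ _ _ _ _ ()))
    exact h.cast rfl (by simp) (by simp)
  have h2 : ∀ s f, Does (loop .aux fun _ : Pos => push .cnt ())
      (stackFill [] [] f s [] D (List.replicate n .blank) [] [])
      (stackFill [] (List.replicate n ()) f s [] D [] [] []) (n * 2 + 1) := by
    intro s f
    have h := does_loop (k := Stk.aux) (b := fun _ : Pos => push .cnt ())
      (fun d r => stackFill [] (List.replicate d.length ()) f s [] D r [] [])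
      (List.replicate n .blank) 1
      (fun _ _ => rfl) (fun d a r _ => by
        rw [update_aux]
        exact (push_cnt _ _ _ _ _ _ _ _ _ ()))
    exact h.cast rfl (by simp) (by simp)
  have h3 := does_loop (k := Stk.fst) (b := fun _ : Unit => .seq (push .snd ()) <|
    .seq (loop .cnt fun _ : Unit => .seq (push .aux .blank) (push .snd ()))
      (loop .aux fun _ : Pos => push .cnt ()))
    (fun d r => stackFill [] (List.replicate n ()) r (List.replicate (d.length * (n + 1)) ()) [] D
      [] [] [])
    (List.replicate x ()) (6 * n + 5) (fun _ _ => rfl) (fun d a r _ => by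
      rw [update_fst]
      refine ((push_snd _ _ _ _ _ _ _ _ _ ()).seq ((h1 _ _).seq (h2 _ _))).cast rfl ?_ (by omega)
      congr 1
      refine unit_list_ext ?_
      simp
      ring)
  have h4 := does_loop (k := Stk.snd) (b := fun _ : Unit => push .fst ())
    (fun d r => stackFill [] (List.replicate n ()) d r [] D [] [] [])
    (List.replicate (x * (n + 1)) ()) 1 (fun _ _ => rfl) (fun d a r _ => by
      rw [update_snd]
      exact (push_fst _ _ _ _ _ _ _ _ _ ()))
  refine (h3.seq (h4.cast (by simp) rfl le_rfl)).cast (by simp) (by simp) ?_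
  rw [List.length_replicate, List.length_replicate]
  nlinarith [Nat.zero_le (x * n), Nat.zero_le x, Nat.zero_le n]

theorem seqList_mulCount_does (n x d : ℕ) (D : List Pos) :
    Does (StackProg.seqList (List.replicate d mulCount))
      (stackFill [] (List.replicate n ()) (List.replicate x ()) [] [] D [] [] [])
      (stackFill [] (List.replicate n ()) (List.replicate (x * (n + 1) ^ d) ()) [] [] D [] [] [])
      (d * (20 * (x + 1) * (n + 1) ^ (d + 1) + 1) + 1) := by
  induction d generalizing x with
  | zero => exact (does_skip _).cast rfl (by simp) (by simp)
  | succ d ih =>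
    refine ((mulCount_does n x D).seq (ih (x * (n + 1)))).cast rfl ?_ ?_
    · congr 2; ring
    · have h1 : 20 * (x + 1) * (n + 1) ≤ 20 * (x + 1) * (n + 1) ^ (d + 1 + 1) :=
        Nat.mul_le_mul_left _ (Nat.le_self_pow (by omega) _)
      have h2 : 20 * (x * (n + 1) + 1) * (n + 1) ^ (d + 1) ≤
          20 * (x + 1) * (n + 1) ^ (d + 1 + 1) := by
        calc _ ≤ (20 * (x + 1) * (n + 1)) * (n + 1) ^ (d + 1) := by
              refine Nat.mul_le_mul_right _ ?_
              nlinarith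
          _ = _ := by ring
      nlinarith

/-- Write `x` to `fst`. -/
def loadCount (x : ℕ) : StackProg Alph :=
  StackProg.seqList (List.replicate x (push .fst ()))

theorem loadCount_does (x : ℕ) (cnt f : List Unit) (D : List Pos) :
    Does (loadCount x) (stackFill [] cnt f [] [] D [] [] [])
      (stackFill [] cnt (List.replicate x () ++ f) [] [] D [] [] []) (2 * x + 1) := by
  induction x generalizing f with
  | zero => exact does_skip _
  | succ x ih =>
    refine ((push_fst _ _ _ _ _ _ _ _ _ ()).seq (ih (() :: f))).cast rfl ?_ (by omega)
    congr 1
    exact unit_list_ext (by simp; omega)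

/-- Write the word of positions, and clear the counter. -/
def writePos : StackProg Alph :=
  .seq (push .todo .last) <| .seq (loop .fst fun _ : Unit => push .todo .blank) <|
  .seq (loop .done fun a : Pos => push .todo a) <| .seq (push .todo .start) <|
  loop .cnt fun _ : Unit => skip

/-- The word is built from its right end. Since `done` contains the input reversed, popping it onto
`todo` restores the order. -/
theorem writePos_does (w : List Bool) (n x : ℕ) :
    Does writePos
      (stackFill [] (List.replicate n ()) (List.replicate x ()) [] [] (w.reverse.map .bit) [] [] [])
      (writing (posWord w x) [] []) (2 * x + 2 * w.length + 2 * n + 20) := by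
  have h1 := does_loop (k := Stk.fst) (b := fun _ : Unit => push .todo .blank)
    (fun d r => stackFill [] (List.replicate n ()) r [] (List.replicate d.length .blank ++ [.last])
      (w.reverse.map .bit) [] [] [])
    (List.replicate x ()) 1 (fun _ _ => rfl) (fun d a r _ => by
      rw [update_fst]
      exact (push_todo _ _ _ _ _ _ _ _ _ .blank))
  have h2 := does_loop (k := Stk.done) (b := fun a : Pos => push .todo a)
    (fun d r => stackFill [] (List.replicate n ()) [] [] (d ++ (List.replicate x .blank ++ [.last]))
      r [] [] [])
    (w.reverse.map .bit) 1 (fun _ _ => rfl) (fun d a r _ => by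
      rw [update_done]
      exact (push_todo _ _ _ _ _ _ _ _ _ a))
  have h3 := does_loop (k := Stk.cnt) (b := fun _ : Unit => skip)
    (fun d r => stackFill [] r [] [] (posWord w x) [] [] [] [])
    (List.replicate n ()) 1 (fun _ _ => rfl) (fun d a r _ => by
      rw [update_cnt]
      exact does_skip _)
  refine ((push_todo _ _ _ _ _ _ _ _ _ .last).seq (h1.seq ((h2.cast (by simp) rfl le_rfl).seq
    ((push_todo _ _ _ _ _ _ _ _ _ .start).seq (h3.cast ?_ rfl le_rfl))))).cast
    (by simp) (by simp) ?_
  · congr 1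
    simp [posWord]
  · simp only [List.length_replicate, List.length_map, List.length_reverse]
    omega

/-- Turn the text and clear the positions. -/
def finish : StackProg Alph :=
  .seq (loop .todo fun _ : Pos => skip) (loop .txt fun a : LoopSym => push .out a)

theorem finish_does (l : List Pos) (txt : List LoopSym) :
    Does finish (writing l [] txt) (stackFill [] [] [] [] [] [] [] [] txt.reverse)
      (2 * l.length + 2 * txt.length + 3) := by
  have h1 := does_loop (k := Stk.todo) (b := fun _ : Pos => skip)
    (fun d r => writing r [] txt) l 1 (fun _ _ => rfl) (fun d a r _ => by
      rw [update_todo]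
      exact does_skip _)
  have h2 := does_loop (k := Stk.txt) (b := fun a : LoopSym => push .out a)
    (fun d r => stackFill [] [] [] [] [] [] [] r d) txt 1 (fun _ _ => rfl) (fun d a r _ => by
      rw [update_txt]
      exact (push_out _ _ _ _ _ _ _ _ _ a))
  exact (h1.seq h2).cast rfl rfl (by omega)

/-- Write three windowed systems, with `c * (n + 1) ^ d` blanks for an input of length `n`. -/
def writeLoop (c d m : ℕ) (T U V : Pos → List Template) : StackProg Alph :=
  .seq readInput <| .seq (loadCount c) <| .seq (StackProg.seqList (List.replicate d mulCount)) <|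
  .seq writePos <| .seq (printSystem m T) <| .seq (printSystem m U) <| .seq (printSystem m V) finish

/-- The text of three windowed systems. -/
def loopText (m : ℕ) (T U V : Pos → List Template) (l : List Pos) : List LoopSym :=
  encodeSystem (windowRows m T 0 l) ++ encodeSystem (windowRows m U 0 l) ++
    encodeSystem (windowRows m V 0 l)

/-- The length of the text written by a program is bounded by its running time. -/
theorem StackProg.Does.length_le {K : Type} {Γ : K → Type} [DecidableEq K] {p : StackProg Γ}
    {S S' : ∀ k, List (Γ k)} {t : ℕ} (h : Does p S S' t) (k : K) :
    (S' k).length ≤ (S k).length + t := by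
  have step : ∀ x y : List (StackProg Γ) × (∀ k, List (Γ k)), contStep x = some y →
      (y.2 k).length ≤ (x.2 k).length + 1 := by
    have upd : ∀ (S : ∀ k, List (Γ k)) (k' : K) (l : List (Γ k')), l.length ≤ (S k').length + 1 →
        (Function.update S k' l k).length ≤ (S k).length + 1 := by
      intro S k' l hl
      by_cases hk : k = k'
      · subst hk; simpa using hl
      · simp [hk]
    rintro ⟨_ | ⟨q, c⟩, S⟩ y hy
    · simp [contStep] at hy
    · cases q <;> simp only [contStep, Option.some.injEq] at hy <;> subst hy
      · simp
      · exact upd _ _ _ (by simp)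
      · simp
      · exact upd _ _ _ (by simp; omega)
  have none_iter : ∀ t, (flip bind (contStep (Γ := Γ)))^[t] none = none := by
    intro t
    induction t with
    | zero => rfl
    | succ t ih => rw [Function.iterate_succ_apply]; exact ih
  have iter : ∀ t x y, (flip bind (contStep (Γ := Γ)))^[t] (some x) = some y →
      (y.2 k).length ≤ (x.2 k).length + t := by
    intro t
    induction t with
    | zero => intro x y h; cases h; simp
    | succ t ih =>
      intro x y h
      rw [Function.iterate_succ_apply] at h
      change (flip bind contStep)^[t] (contStep x) = _ at h
      cases hz : contStep x with
      | none => rw [hz, none_iter] at h; cases h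
      | some z =>
        rw [hz] at h
        have h1 := step x z hz
        have h2 := ih z y h
        omega
  obtain ⟨t', ht, h⟩ := h []
  have := iter _ _ _ h
  simp only at this
  omega

/-- The templates are constants of the program; only the word of positions depends on the input, and
its length is polynomial. -/
theorem exists_does_writeLoop (c d m : ℕ) (T U V : Pos → List Template) :
    ∃ time : Polynomial ℕ, ∀ w : List Bool, Does (writeLoop c d m T U V)
      (stackFill w [] [] [] [] [] [] [] [])
      (stackFill [] [] [] [] [] [] [] []
        (loopText m T U V (posWord w (c * (w.length + 1) ^ d)))) (time.eval w.length) := by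
  obtain ⟨c1, h1⟩ := exists_does_printSystem m T
  obtain ⟨c2, h2⟩ := exists_does_printSystem m U
  obtain ⟨c3, h3⟩ := exists_does_printSystem m V
  let X : Polynomial ℕ := Polynomial.X
  -- `N` is the length of the word of positions, and `P` bounds the time for the three systems up to
  -- the overhead of sequencing.
  let N : Polynomial ℕ := X + Polynomial.C c * (X + 1) ^ d + 2
  let P : Polynomial ℕ := Polynomial.C (c1 + c2 + c3) * (N + 1) ^ 2
  refine ⟨(X * 4 + 1) + (Polynomial.C (2 * c + 1)) +
    (Polynomial.C d * (20 * Polynomial.C (c + 1) * (X + 1) ^ (d + 1) + 1) + 1) +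
    (2 * N + 2 * X + 2 * X + 20) + P + (2 * N + 2 * P + 3) + 20, fun w => ?_⟩
  generalize hl : posWord w (c * (w.length + 1) ^ d) = l
  have hlen : l.length = N.eval w.length := by
    rw [← hl, length_posWord]; simp [N, X]
  have g1 := h1 l []
  have g2 := h2 l ((encodeSystem (windowRows m T 0 l)).reverse ++ [])
  have g3 := h3 l ((encodeSystem (windowRows m U 0 l)).reverse ++
    ((encodeSystem (windowRows m T 0 l)).reverse ++ []))
  have g := g1.seq (g2.seq g3)
  have hP : (c1 + c2 + c3) * (l.length + 1) ^ 2 = P.eval w.length := by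
    rw [hlen]; simp [P]
  -- `finish` takes time proportional to the length of the text, which the time spent on writing it
  -- bounds.
  have glen := g.length_le .txt
  have e := finish_does l ((encodeSystem (windowRows m V 0 l)).reverse ++
    ((encodeSystem (windowRows m U 0 l)).reverse ++
      ((encodeSystem (windowRows m T 0 l)).reverse ++ [])))
  have hx : c * (w.length + 1) ^ d ≤ l.length := by rw [← hl, length_posWord]; omega
  have hpos := writePos_does w w.length (c * (w.length + 1) ^ d)
  rw [hl] at hpos
  refine ((readInput_does w).seq ((loadCount_does c _ [] _).seq (Does.seq
    ((seqList_mulCount_does w.length c d _).cast (by rw [List.append_nil]) rfl le_rfl)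
    (hpos.seq (g1.seq (g2.seq (g3.seq e))))))).cast rfl ?_ ?_
  · simp [loopText]
  · simp only [stackFill, List.length_nil] at glen
    simp only [Polynomial.eval_add, Polynomial.eval_mul, Polynomial.eval_pow, Polynomial.eval_C,
      Polynomial.eval_ofNat, Polynomial.eval_one, ← hP, ← hlen]
    simp only [X, Polynomial.eval_X]
    nlinarith

/-! ### Loops given by lists of rows -/

/-- The value of a linear form with the coefficients of a list. -/
def lin : List ℤ → (ℕ → ℚ) → ℚ
  | [], _ => 0
  | c :: L, z => c * z 0 + lin L fun j => z (j + 1)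

theorem lin_append (L L' : List ℤ) (z : ℕ → ℚ) :
    lin (L ++ L') z = lin L z + lin L' fun j => z (L.length + j) := by
  induction L generalizing z with
  | nil => simp [lin]
  | cons c L ih =>
    rw [List.cons_append, lin, ih, lin, add_assoc]
    congr 3
    funext j
    rw [List.length_cons]
    congr 1
    omega

theorem lin_replicate_zero (n : ℕ) (z : ℕ → ℚ) : lin (List.replicate n 0) z = 0 := by
  induction n generalizing z with
  | zero => rfl
  | succ n ih => rw [List.replicate_succ, lin, ih]; simp

theorem lin_ofFn {n : ℕ} (f : Fin n → ℤ) (z : ℕ → ℚ) :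
    lin (List.ofFn f) z = ∑ i, (f i : ℚ) * z i := by
  induction n generalizing z with
  | zero => rfl
  | succ n ih => rw [List.ofFn_succ, lin, ih, Fin.sum_univ_succ]; rfl

/-- A point, extended by zeros. -/
def extendZero {n : ℕ} (x : Fin n → ℚ) (j : ℕ) : ℚ := if h : j < n then x ⟨j, h⟩ else 0

theorem extendZero_coe {n : ℕ} (x : Fin n → ℚ) (j : Fin n) : extendZero x j = x j := by
  simp [extendZero]

/-- `R` stands for the rest of a row: the coefficients of the second state, if any, and the
right-hand side. -/
theorem sum_getD {n : ℕ} (L R : List ℤ) (hL : L.length = n) (x : Fin n → ℚ) :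
    ∑ j : Fin n, (((L ++ R).getD j 0 : ℤ) : ℚ) * x j = lin L (extendZero x) := by
  subst hL
  have h : lin L (extendZero x) = lin (List.ofFn L.get) (extendZero x) := by rw [List.ofFn_get]
  rw [h, lin_ofFn]
  refine Finset.sum_congr rfl fun j _ => ?_
  rw [extendZero_coe, List.getD_append _ _ _ _ j.2]
  simp

/-- The loop whose matrices have the given rows. -/
def rowLoop (n : ℕ) (T U V : List (List ℤ)) (hT : 0 < T.length) (hU : 0 < U.length)
    (hV : 0 < V.length) : SLCLoop where
  n := n
  r := T.length
  p := U.length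
  q := V.length
  r_pos := hT
  p_pos := hU
  q_pos := hV
  C := fun i j => T[i].getD j 0
  c := fun i => T[i].getD n 0
  B := fun i j => U[i].getD j 0
  b := fun i => U[i].getD n 0
  A := fun i => Sum.elim (fun j => V[i].getD j 0) (fun j => V[i].getD (n + j) 0)
  a := fun i => V[i].getD (n + n) 0

theorem ofFn_getD_append (n : ℕ) (v : List ℤ) (hv : v.length = n + 1) :
    List.ofFn (fun j : Fin n => v.getD j 0) ++ [v.getD n 0] = v := by
  refine List.ext_getElem (by simp [hv]) fun i h1 h2 => ?_
  rw [List.getElem_append]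
  split_ifs with h
  · simp [h2]
  · simp only [List.length_ofFn] at h
    obtain rfl : i = n := by omega
    simp [h2]

theorem ofFn_getElem_map {α β : Type*} (L : List α) (f : α → β) :
    (List.ofFn fun i : Fin L.length => f L[i]) = L.map f := by
  refine List.ext_getElem (by simp) fun i h1 h2 => by simp

/-- The row lengths matter: for other lengths the default value of `getD` would pad the rows, or the
matrices would truncate them. -/
theorem rowLoop_encode (n : ℕ) (T U V : List (List ℤ)) (hT : 0 < T.length) (hU : 0 < U.length)
    (hV : 0 < V.length) (lT : ∀ v ∈ T, v.length = n + 1) (lU : ∀ v ∈ U, v.length = n + 1)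
    (lV : ∀ v ∈ V, v.length = n + n + 1) :
    (rowLoop n T U V hT hU hV).encode = encodeSystem T ++ encodeSystem U ++ encodeSystem V := by
  have h1 : ∀ W : List (List ℤ), (∀ v ∈ W, v.length = n + 1) →
      (List.ofFn fun i : Fin W.length => List.ofFn (fun j : Fin n => W[i].getD j 0) ++
        [W[i].getD n 0]) = W := by
    intro W hW
    refine (ofFn_getElem_map W fun v => List.ofFn (fun j : Fin n => v.getD j 0) ++
      [v.getD n 0]).trans ?_
    conv_rhs => rw [← List.map_id W]
    exact List.map_congr_left fun v hv => ofFn_getD_append n v (hW v hv)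
  have h2 : (List.ofFn fun i : Fin V.length => List.ofFn (fun j : Fin n => V[i].getD j 0) ++
      List.ofFn (fun j : Fin n => V[i].getD (n + j) 0) ++ [V[i].getD (n + n) 0]) = V := by
    refine (ofFn_getElem_map V fun v => List.ofFn (fun j : Fin n => v.getD j 0) ++
      List.ofFn (fun j : Fin n => v.getD (n + j) 0) ++ [v.getD (n + n) 0]).trans ?_
    conv_rhs => rw [← List.map_id V]
    refine List.map_congr_left fun v hv => ?_
    conv_rhs => rw [id, ← ofFn_getD_append (n + n) v (lV v hv), List.ofFn_add]
    rfl
  have e1 : (rowLoop n T U V hT hU hV).preRows = T := h1 T lT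
  have e2 : (rowLoop n T U V hT hU hV).guardRows = U := h1 U lU
  have e3 : (rowLoop n T U V hT hU hV).updateRows = V := h2
  rw [SLCLoop.encode, e1, e2, e3]

/-! ### Windowed systems as constraints -/

theorem mem_windowRows (m : ℕ) (T : Pos → List Template) (l : List Pos) (i : ℕ) (v : List ℤ) :
    v ∈ windowRows m T i l ↔ ∃ (k : Fin l.length), ∃ R ∈ T l[k],
      v = templateRow m (i + k) (l.length - 1 - k) R := by
  induction l generalizing i with
  | nil => simp [windowRows]
  | cons a l ih =>
    rw [windowRows, List.mem_append, ih, List.mem_map]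
    constructor
    · rintro (⟨R, hR, rfl⟩ | ⟨k, R, hR, rfl⟩)
      · exact ⟨⟨0, by simp⟩, R, hR, by simp⟩
      · refine ⟨k.succ, R, hR, ?_⟩
        congr 1
        · simp; omega
        · simp; omega
    · rintro ⟨⟨_ | k, hk⟩, R, hR, rfl⟩
      · exact .inl ⟨R, hR, by simp⟩
      · refine .inr ⟨⟨k, by simpa using hk⟩, R, hR, ?_⟩
        congr 1
        · simp; omega
        · simp; omega

section Window

variable {Q S : Type} [Fintype Q] [Fintype S]

variable (Q S) in
/-- The variables of a window: a control part, a counter, and three blocks. -/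
abbrev Window : Type := Q ⊕ Unit ⊕ (Fin 3 × S)

variable (Q S) in
/-- The number of variables of a state with `N + 2` blocks. -/
def numVars (N : ℕ) : ℕ := Fintype.card Q + (1 + (N + 2) * Fintype.card S)

variable (Q S) in
/-- The numbering of the variables of a state. -/
noncomputable def varEquiv (N : ℕ) : Q ⊕ Unit ⊕ (Fin (N + 2) × S) ≃ Fin (numVars Q S N) :=
  (Equiv.sumCongr (Fintype.equivFin Q)
    ((Equiv.sumCongr finOneEquiv.symm
      ((Equiv.prodCongr (Equiv.refl _) (Fintype.equivFin S)).trans finProdFinEquiv)).trans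
        finSumFinEquiv)).trans finSumFinEquiv

/-- The three position formulas say that the columns are ordered as the templates print them:
control, counter, then the blocks one after another. -/
theorem varEquiv_control (N : ℕ) (q : Q) :
    (varEquiv Q S N (.inl q) : ℕ) = Fintype.equivFin Q q := rfl

theorem varEquiv_counter (N : ℕ) :
    (varEquiv Q S N (.inr (.inl ())) : ℕ) = Fintype.card Q := rfl

theorem varEquiv_block (N : ℕ) (j : Fin (N + 2)) (a : S) :
    (varEquiv Q S N (.inr (.inr (j, a))) : ℕ) =
      Fintype.card Q + (1 + (Fintype.equivFin S a + Fintype.card S * j)) := rfl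

/-- The view of a state through the window at position `k`. -/
noncomputable def view {N : ℕ} (x : Fin (numVars Q S N) → ℚ) (k : Fin N) : Window Q S → ℚ
  | .inl q => x (varEquiv Q S N (.inl q))
  | .inr (.inl _) => x (varEquiv Q S N (.inr (.inl ())))
  | .inr (.inr (b, a)) => x (varEquiv Q S N (.inr (.inr (⟨k + b, by omega⟩, a))))

/-- The piece of a template with the given coefficients. -/
noncomputable def piece (h : Window Q S → ℤ) : List ℤ × List ℤ :=
  (List.ofFn (fun i => h (.inl ((Fintype.equivFin Q).symm i))) ++ [h (.inr (.inl ()))],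
    List.ofFn fun i : Fin (3 * Fintype.card S) =>
      h (.inr (.inr ((finProdFinEquiv.symm i).1, (Fintype.equivFin S).symm
        (finProdFinEquiv.symm i).2))))

/-- The value of a linear form on a window. -/
def windowForm (h : Window Q S → ℤ) (y : Window Q S → ℚ) : ℚ := ∑ v, (h v : ℚ) * y v

theorem length_widen_piece (h : Window Q S → ℤ) {N i j : ℕ} (hN : i + j + 1 = N) :
    (widen (Fintype.card S) i j (piece h)).length = numVars Q S N := by
  subst hN
  simp [widen, piece, numVars]
  ring

/-- With `k` zero blocks in front, the three blocks of the window meet the blocks `k`, `k + 1`, `k +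
2`. The `N - 1 - k` zero blocks behind complete the `N + 2` blocks. -/
theorem lin_widen_piece (h : Window Q S → ℤ) {N : ℕ} (k : Fin N) (x : Fin (numVars Q S N) → ℚ) :
    lin (widen (Fintype.card S) k (N - 1 - k) (piece h)) (extendZero x) =
      windowForm h (view x k) := by
  have e : ∀ (g : Q ⊕ Unit ⊕ (Fin (N + 2) × S)) (j : ℕ), (varEquiv Q S N g : ℕ) = j →
      extendZero x j = x (varEquiv Q S N g) := by
    rintro g _ rfl
    exact extendZero_coe _ _
  rw [widen, piece, lin_append, lin_append, lin_append, lin_append, lin_replicate_zero,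
    lin_replicate_zero, lin_ofFn, lin_ofFn, windowForm, Fintype.sum_sum_type, Fintype.sum_sum_type,
    add_zero, add_zero, add_assoc]
  congr 1
  · rw [← (Fintype.equivFin Q).sum_comp]
    refine Finset.sum_congr rfl fun q _ => ?_
    rw [Equiv.symm_apply_apply, view, e _ _ (varEquiv_control N q)]
  congr 1
  · simp only [lin, List.length_ofFn, add_zero, Finset.univ_unique, Finset.sum_singleton]
    rw [view, e _ _ (varEquiv_counter N)]
  · rw [← finProdFinEquiv.sum_comp, Fintype.sum_prod_type, Fintype.sum_prod_type]
    refine Finset.sum_congr rfl fun b _ => ?_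
    rw [← (Fintype.equivFin S).sum_comp]
    refine Finset.sum_congr rfl fun a _ => ?_
    rw [Equiv.symm_apply_apply, Equiv.symm_apply_apply, view,
      e _ _ ((varEquiv_block N ⟨k + b, by omega⟩ a).trans _)]
    simp
    ring

variable (T : Pos → List ((Window Q S → ℤ) × ℤ))
  (V : Pos → List ((Window Q S → ℤ) × (Window Q S → ℤ) × ℤ))

/-- The templates of constraints on one state. -/
noncomputable def stateTemplates (a : Pos) : List Template := (T a).map fun R => ([piece R.1], R.2)

/-- The templates of constraints on two states. -/
noncomputable def transTemplates (a : Pos) : List Template :=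
  (V a).map fun R => ([piece R.1, piece R.2.1], R.2.2)

/-- The rows of the constraints on one state. -/
noncomputable def stateRows (l : List Pos) : List (List ℤ) :=
  windowRows (Fintype.card S) (stateTemplates T) 0 l

/-- The rows of the constraints on two states. -/
noncomputable def transRows (l : List Pos) : List (List ℤ) :=
  windowRows (Fintype.card S) (transTemplates V) 0 l

theorem mem_stateRows (l : List Pos) (v : List ℤ) : v ∈ stateRows T l ↔
    ∃ k : Fin l.length, ∃ R ∈ T l[k],
      v = widen (Fintype.card S) k (l.length - 1 - k) (piece R.1) ++ [R.2] := by
  rw [stateRows, mem_windowRows]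
  refine exists_congr fun k => ⟨?_, ?_⟩
  · rintro ⟨R, hR, rfl⟩
    obtain ⟨R', hR', rfl⟩ := List.mem_map.1 hR
    exact ⟨R', hR', by simp [templateRow]⟩
  · rintro ⟨R, hR, rfl⟩
    exact ⟨_, List.mem_map.2 ⟨R, hR, rfl⟩, by simp [templateRow]⟩

theorem mem_transRows (l : List Pos) (v : List ℤ) : v ∈ transRows V l ↔
    ∃ k : Fin l.length, ∃ R ∈ V l[k],
      v = widen (Fintype.card S) k (l.length - 1 - k) (piece R.1) ++
        (widen (Fintype.card S) k (l.length - 1 - k) (piece R.2.1) ++ [R.2.2]) := by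
  rw [transRows, mem_windowRows]
  refine exists_congr fun k => ⟨?_, ?_⟩
  · rintro ⟨R, hR, rfl⟩
    obtain ⟨R', hR', rfl⟩ := List.mem_map.1 hR
    exact ⟨R', hR', by simp [templateRow]⟩
  · rintro ⟨R, hR, rfl⟩
    exact ⟨_, List.mem_map.2 ⟨R, hR, rfl⟩, by simp [templateRow]⟩

theorem length_of_mem_stateRows (l : List Pos) (v : List ℤ) (h : v ∈ stateRows T l) :
    v.length = numVars Q S l.length + 1 := by
  obtain ⟨k, R, -, rfl⟩ := (mem_stateRows T l v).1 h
  rw [List.length_append, length_widen_piece (N := l.length) _ (by omega)]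
  rfl

theorem length_of_mem_transRows (l : List Pos) (v : List ℤ) (h : v ∈ transRows V l) :
    v.length = numVars Q S l.length + numVars Q S l.length + 1 := by
  obtain ⟨k, R, -, rfl⟩ := (mem_transRows V l v).1 h
  rw [List.length_append, List.length_append, length_widen_piece (N := l.length) _ (by omega),
    length_widen_piece (N := l.length) _ (by omega)]
  rfl

/-- Translates the matrix inequalities into local conditions on windows; `transRows_holds` does so
for pairs of states. -/
theorem stateRows_holds (l : List Pos) (x : Fin (numVars Q S l.length) → ℚ) :
    (∀ i : Fin (stateRows T l).length,
      ∑ j : Fin (numVars Q S l.length), (((stateRows T l)[i].getD j 0 : ℤ) : ℚ) * x j ≤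
        (((stateRows T l)[i].getD (numVars Q S l.length) 0 : ℤ) : ℚ)) ↔
    ∀ k : Fin l.length, ∀ R ∈ T l[k], windowForm R.1 (view x k) ≤ R.2 := by
  have h1 : (∀ i : Fin (stateRows T l).length,
      ∑ j : Fin (numVars Q S l.length), (((stateRows T l)[i].getD j 0 : ℤ) : ℚ) * x j ≤
        (((stateRows T l)[i].getD (numVars Q S l.length) 0 : ℤ) : ℚ)) ↔
      ∀ v ∈ stateRows T l, ∑ j : Fin (numVars Q S l.length), ((v.getD j 0 : ℤ) : ℚ) * x j ≤
        ((v.getD (numVars Q S l.length) 0 : ℤ) : ℚ) := by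
    rw [List.forall_mem_iff_forall_getElem]
    exact ⟨fun h i hi => h ⟨i, hi⟩, fun h i => h i i.2⟩
  have h2 : ∀ (k : Fin l.length) (R : (Window Q S → ℤ) × ℤ),
      (∑ j : Fin (numVars Q S l.length),
        (((widen (Fintype.card S) k (l.length - 1 - k) (piece R.1) ++ [R.2]).getD j 0 : ℤ) : ℚ) * x j ≤
        (((widen (Fintype.card S) k (l.length - 1 - k) (piece R.1) ++ [R.2]).getD
          (numVars Q S l.length) 0 : ℤ) : ℚ)) ↔ windowForm R.1 (view x k) ≤ R.2 := by
    intro k R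
    have hl := length_widen_piece (N := l.length) (i := k) (j := l.length - 1 - k) R.1 (by omega)
    rw [sum_getD _ _ hl, lin_widen_piece, List.getD_append_right _ _ _ _ hl.le, hl, Nat.sub_self]
    rfl
  rw [h1]
  constructor
  · intro h k R hR
    exact (h2 k R).1 (h _ ((mem_stateRows T l _).2 ⟨k, R, hR, rfl⟩))
  · intro h v hv
    obtain ⟨k, R, hR, rfl⟩ := (mem_stateRows T l v).1 hv
    exact (h2 k R).2 (h k R hR)

theorem transRows_holds (l : List Pos) (x x' : Fin (numVars Q S l.length) → ℚ) :
    (∀ i : Fin (transRows V l).length,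
      ∑ j : Fin (numVars Q S l.length), (((transRows V l)[i].getD j 0 : ℤ) : ℚ) * x j +
      ∑ j : Fin (numVars Q S l.length),
        (((transRows V l)[i].getD (numVars Q S l.length + j) 0 : ℤ) : ℚ) * x' j ≤
        (((transRows V l)[i].getD (numVars Q S l.length + numVars Q S l.length) 0 : ℤ) : ℚ)) ↔
    ∀ k : Fin l.length, ∀ R ∈ V l[k],
      windowForm R.1 (view x k) + windowForm R.2.1 (view x' k) ≤ R.2.2 := by
  have h1 : (∀ i : Fin (transRows V l).length,
      ∑ j : Fin (numVars Q S l.length), (((transRows V l)[i].getD j 0 : ℤ) : ℚ) * x j +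
      ∑ j : Fin (numVars Q S l.length),
        (((transRows V l)[i].getD (numVars Q S l.length + j) 0 : ℤ) : ℚ) * x' j ≤
        (((transRows V l)[i].getD (numVars Q S l.length + numVars Q S l.length) 0 : ℤ) : ℚ)) ↔
      ∀ v ∈ transRows V l, ∑ j : Fin (numVars Q S l.length), ((v.getD j 0 : ℤ) : ℚ) * x j +
      ∑ j : Fin (numVars Q S l.length), ((v.getD (numVars Q S l.length + j) 0 : ℤ) : ℚ) * x' j ≤
        ((v.getD (numVars Q S l.length + numVars Q S l.length) 0 : ℤ) : ℚ) := by
    rw [List.forall_mem_iff_forall_getElem]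
    exact ⟨fun h i hi => h ⟨i, hi⟩, fun h i => h i i.2⟩
  have h2 : ∀ (k : Fin l.length) (R : (Window Q S → ℤ) × (Window Q S → ℤ) × ℤ) (v : List ℤ),
      v = widen (Fintype.card S) k (l.length - 1 - k) (piece R.1) ++
        (widen (Fintype.card S) k (l.length - 1 - k) (piece R.2.1) ++ [R.2.2]) →
      (∑ j : Fin (numVars Q S l.length), ((v.getD j 0 : ℤ) : ℚ) * x j +
      ∑ j : Fin (numVars Q S l.length), ((v.getD (numVars Q S l.length + j) 0 : ℤ) : ℚ) * x' j ≤
        ((v.getD (numVars Q S l.length + numVars Q S l.length) 0 : ℤ) : ℚ) ↔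
      windowForm R.1 (view x k) + windowForm R.2.1 (view x' k) ≤ R.2.2) := by
    rintro k R v rfl
    have hl := length_widen_piece (N := l.length) (i := k) (j := l.length - 1 - k) R.1 (by omega)
    have hl' := length_widen_piece (N := l.length) (i := k) (j := l.length - 1 - k) R.2.1 (by omega)
    have h3 : ∀ j : ℕ, (widen (Fintype.card S) k (l.length - 1 - k) (piece R.1) ++
        (widen (Fintype.card S) k (l.length - 1 - k) (piece R.2.1) ++ [R.2.2])).getD
          (numVars Q S l.length + j) 0 =
        (widen (Fintype.card S) k (l.length - 1 - k) (piece R.2.1) ++ [R.2.2]).getD j 0 := by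
      intro j
      rw [List.getD_append_right _ _ _ _ (by omega), hl, Nat.add_sub_cancel_left]
    simp only [h3]
    rw [sum_getD _ _ hl, sum_getD _ _ hl', lin_widen_piece, lin_widen_piece,
      List.getD_append_right _ _ _ _ hl'.le, hl', Nat.sub_self]
    rfl
  rw [h1]
  constructor
  · intro h k R hR
    exact (h2 k R _ rfl).1 (h _ ((mem_transRows V l _).2 ⟨k, R, hR, rfl⟩))
  · intro h v hv
    obtain ⟨k, R, hR, hv⟩ := (mem_transRows V l v).1 hv
    exact (h2 k R v hv).2 (h k R hR)

/-! ### Linear forms on windows -/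

theorem windowForm_zero (y : Window Q S → ℚ) : windowForm 0 y = 0 := by simp [windowForm]

theorem windowForm_add (g h : Window Q S → ℤ) (y : Window Q S → ℚ) :
    windowForm (g + h) y = windowForm g y + windowForm h y := by
  simp [windowForm, add_mul, Finset.sum_add_distrib]

theorem windowForm_neg (h : Window Q S → ℤ) (y : Window Q S → ℚ) :
    windowForm (-h) y = -windowForm h y := by
  simp [windowForm]

theorem windowForm_sum {ι : Type*} (s : Finset ι) (h : ι → Window Q S → ℤ) (y : Window Q S → ℚ) :
    windowForm (∑ i ∈ s, h i) y = ∑ i ∈ s, windowForm (h i) y := by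
  classical
  induction s using Finset.induction_on with
  | empty => simp [windowForm_zero]
  | insert i s hi ih => rw [Finset.sum_insert hi, Finset.sum_insert hi, windowForm_add, ih]

open Classical in
/-- The linear form given by a variable. -/
noncomputable def windowVar (v : Window Q S) : Window Q S → ℤ := Pi.single v 1

theorem windowForm_var (v : Window Q S) (y : Window Q S → ℚ) :
    windowForm (windowVar v) y = y v := by
  simp [windowForm, windowVar, Pi.single_apply]

end Window

/-! ### Loops with a single computation -/

/-- The update is required to be functional only at points of the trace, so nothing has to be known
about other rational states. -/
theorem SLCLoop.reachable_iff_of_trace (L : SLCLoop) (x : ℕ → L.State) (P : ℕ → Prop)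
    (init : ∀ y, L.Initial y ↔ y = x 0) (guard : ∀ i, L.Guard (x i) ↔ P i)
    (upd : ∀ i y, L.Update (x i) y ↔ y = x (i + 1)) (y : L.State) :
    L.Reachable y ↔ ∃ i, y = x i ∧ ∀ j < i, P j := by
  constructor
  · rintro ⟨y₀, h0, h⟩
    induction h with
    | refl => exact ⟨0, (init _).1 h0, by simp⟩
    | tail _ h ih =>
      obtain ⟨i, rfl, hi⟩ := ih
      refine ⟨i + 1, (upd _ _).1 h.2, fun j hj => ?_⟩
      rcases Nat.lt_succ_iff_lt_or_eq.1 hj with hj | rfl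
      · exact hi j hj
      · exact (guard _).1 h.1
  · rintro ⟨i, rfl, hi⟩
    refine ⟨x 0, (init _).2 rfl, ?_⟩
    induction i with
    | zero => exact .refl
    | succ i ih =>
      exact (ih fun j hj => hi j (by omega)).tail ⟨(guard i).2 (hi i (by omega)), (upd _ _).2 rfl⟩

theorem SLCLoop.deterministic_of_trace (L : SLCLoop) (x : ℕ → L.State) (P : ℕ → Prop)
    (init : ∀ y, L.Initial y ↔ y = x 0) (guard : ∀ i, L.Guard (x i) ↔ P i)
    (upd : ∀ i y, L.Update (x i) y ↔ y = x (i + 1)) : L.Deterministic := by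
  intro y hy _ z z' hz hz'
  obtain ⟨i, rfl, -⟩ := (L.reachable_iff_of_trace x P init guard upd y).1 hy
  rw [(upd _ _).1 hz, (upd _ _).1 hz']

/-- A loop with a single computation that counts its steps has a linear ranking function if and only
if the computation is finite. -/
theorem SLCLoop.linRF_iff_of_trace (L : SLCLoop) (x : ℕ → L.State) (P : ℕ → Prop)
    (init : ∀ y, L.Initial y ↔ y = x 0) (guard : ∀ i, L.Guard (x i) ↔ P i)
    (upd : ∀ i y, L.Update (x i) y ↔ y = x (i + 1)) (c : Fin L.n) (hc : ∀ i, x i c = i) :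
    L.LinRF ↔ ∃ i, ¬ P i := by
  have reach := L.reachable_iff_of_trace x P init guard upd
  constructor
  · rintro ⟨lam, lam₀, h⟩
    by_contra! hP
    set ρ : ℕ → ℚ := fun i => ∑ j, lam j * x i j + lam₀ with hρ
    have step : ∀ i, 0 ≤ ρ i ∧ 1 ≤ ρ i - ρ (i + 1) := fun i =>
      h (x i) (x (i + 1)) ⟨(reach _).2 ⟨i, rfl, fun j _ => hP j⟩, (guard i).2 (hP i), (upd _ _).2 rfl⟩
    have le : ∀ i : ℕ, ρ i ≤ ρ 0 - i := by
      intro i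
      induction i with
      | zero => simp
      | succ i ih => have := (step i).2; push_cast; linarith
    obtain ⟨i, hi⟩ := exists_nat_gt (ρ 0)
    linarith [le i, (step i).1]
  · rintro ⟨m, hm⟩
    -- The ranking function is `m` minus the counter, where the loop condition fails at time `m`;
    -- every reachable transition starts before that time.
    refine ⟨fun j => if j = c then -1 else 0, m, ?_⟩
    rintro y y' ⟨hy, ht⟩
    simp only at hy ht
    obtain ⟨i, rfl, hi⟩ := (reach y).1 hy
    obtain rfl := (upd _ _).1 ht.2
    have him : i < m := by
      by_contra! hle
      rcases hle.lt_or_eq with hlt | rfl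
      · exact hm (hi m hlt)
      · exact hm ((guard _).1 ht.1)
    have him' : (i : ℚ) + 1 ≤ m := by exact_mod_cast him
    simp only [ite_mul, zero_mul, Finset.sum_ite_eq', Finset.mem_univ, if_true, hc]
    push_cast
    constructor <;> linarith

theorem rowLoop_correct_of_trace {n : ℕ} {T U V : List (List ℤ)} {hT : 0 < T.length}
    {hU : 0 < U.length} {hV : 0 < V.length} (x : ℕ → Fin n → ℚ) (P : ℕ → Prop)
    (init : ∀ y : Fin n → ℚ, (∀ i : Fin T.length,
      ∑ j : Fin n, ((T[i].getD j 0 : ℤ) : ℚ) * y j ≤ ((T[i].getD n 0 : ℤ) : ℚ)) ↔ y = x 0)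
    (guard : ∀ k, (∀ i : Fin U.length,
      ∑ j : Fin n, ((U[i].getD j 0 : ℤ) : ℚ) * x k j ≤ ((U[i].getD n 0 : ℤ) : ℚ)) ↔ P k)
    (upd : ∀ k, ∀ y : Fin n → ℚ, (∀ i : Fin V.length,
      ∑ j : Fin n, ((V[i].getD j 0 : ℤ) : ℚ) * x k j +
        ∑ j : Fin n, ((V[i].getD (n + j) 0 : ℤ) : ℚ) * y j ≤ ((V[i].getD (n + n) 0 : ℤ) : ℚ)) ↔
      y = x (k + 1))
    (c : Fin n) (hc : ∀ i, x i c = i) :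
    (rowLoop n T U V hT hU hV).Deterministic ∧
      ((rowLoop n T U V hT hU hV).LinRF ↔ ∃ i, ¬ P i) := by
  have upd' : ∀ k, ∀ y : Fin n → ℚ, (rowLoop n T U V hT hU hV).Update (x k) y ↔ y = x (k + 1) := by
    intro k y
    rw [← upd k y]
    refine forall_congr' fun i => ?_
    rw [Fintype.sum_sum_type]
    rfl
  have init' : ∀ y : Fin n → ℚ, (rowLoop n T U V hT hU hV).Initial y ↔ y = x 0 := fun y => init y
  have guard' : ∀ k, (rowLoop n T U V hT hU hV).Guard (x k) ↔ P k := fun k => guard k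
  exact ⟨(rowLoop n T U V hT hU hV).deterministic_of_trace x P init' guard' upd',
    (rowLoop n T U V hT hU hV).linRF_iff_of_trace x P init' guard' upd' c hc⟩

/-! ### Multi-stack machines -/

/-- What a machine does to a stack in a step. -/
inductive StackAct (α : Type)
  | stay
  | push (a : α)
  | pop

/-- The stack after an action. -/
def StackAct.apply {α : Type} : StackAct α → List α → List α
  | stay, l => l
  | push a, l => a :: l
  | pop, l => l.tail

/-- The symbols of the stacks at some depth. -/
abbrev Cell {K : Type} (Γ : K → Type) : Type := ∀ k, Option (Γ k)

/-- A machine with several stacks, which performs at most one action on each stack in a step. -/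
structure StackMachine (Q : Type) {K : Type} (Γ : K → Type) where
  /-- the initial control state -/
  start : Q
  /-- the accepting control state -/
  accept : Q
  /-- the next control state, for given topmost symbols -/
  next : Q → Cell Γ → Q
  /-- the actions on the stacks -/
  act : Q → ∀ k, StackAct (Γ k)
  next_accept : ∀ c, next accept c = accept

namespace StackMachine

variable {Q K : Type} {Γ : K → Type} (M : StackMachine Q Γ)

/-- A step of the machine. -/
def step (c : Q × (∀ k, List (Γ k))) : Q × (∀ k, List (Γ k)) :=
  (M.next c.1 fun k => (c.2 k).head?, fun k => (M.act c.1 k).apply (c.2 k))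

/-- The symbols of the blocks that represent stacks: the cells of the depths below `N`, between two
marks. -/
def tape (N : ℕ) (S : ∀ k, List (Γ k)) (j : ℕ) : Option (Cell Γ) :=
  if 1 ≤ j ∧ j ≤ N then some fun k => (S k)[j - 1]? else none

/-- The next symbol of a block, given the symbols of its neighbours and its own symbol. -/
def localStep (q : Q) (l m r : Option (Cell Γ)) : Option (Cell Γ) :=
  m.map fun c k => match M.act q k with
    | .stay => c k
    -- A mark on the left means that this is the top cell.
    | .push a => l.elim (some a) fun d => d k
    | .pop => r.elim none fun d => d k

/-- A push or a pop shifts the symbols by one cell. The length bound enters at a pop in cell `N`,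
where the right mark is read as an empty cell; a symbol beyond the tape would be lost there. -/
theorem localStep_tape (N : ℕ) (q : Q) (S : ∀ k, List (Γ k)) (hS : ∀ k, (S k).length ≤ N) (j : ℕ)
    (h1 : 1 ≤ j) (h2 : j ≤ N) :
    M.localStep q (tape N S (j - 1)) (tape N S j) (tape N S (j + 1)) =
      tape N (fun k => (M.act q k).apply (S k)) j := by
  obtain ⟨j, rfl⟩ : ∃ i, j = i + 1 := ⟨j - 1, by omega⟩
  simp only [localStep, tape, h1, h2, and_self, if_true, Option.map_some, Nat.add_sub_cancel]
  congr 1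
  funext k
  cases M.act q k with
  | stay => rfl
  | push a =>
    rcases j with _ | j
    · simp [StackAct.apply]
    · have : 1 ≤ j + 1 ∧ j + 1 ≤ N := by omega
      simp [StackAct.apply, this]
  | pop =>
    by_cases hj : j + 1 + 1 ≤ N
    · simp [StackAct.apply, hj, List.getElem?_tail]
    · have : (S k).length ≤ j + 1 := by have := hS k; omega
      simp [StackAct.apply, hj, this]

variable [Fintype Q] [Fintype K] [DecidableEq K] [∀ k, Fintype (Γ k)]

open Classical in
/-- The point that represents a control state, a counter and a tape. -/
noncomputable def point (N : ℕ) (q : Q) (t : ℚ) (τ : ℕ → Option (Cell Γ)) :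
    Fin (numVars Q (Option (Cell Γ)) N) → ℚ := fun i =>
  match (varEquiv Q (Option (Cell Γ)) N).symm i with
  | .inl q' => if q' = q then 1 else 0
  | .inr (.inl _) => t
  | .inr (.inr (j, a)) => if a = τ j then 1 else 0

open Classical in
theorem eq_point_iff {N : ℕ} (x : Fin (numVars Q (Option (Cell Γ)) N) → ℚ) (q : Q) (t : ℚ)
    (τ : ℕ → Option (Cell Γ)) : x = point N q t τ ↔
      (∀ q', x (varEquiv Q (Option (Cell Γ)) N (.inl q')) = if q' = q then 1 else 0) ∧
      x (varEquiv Q (Option (Cell Γ)) N (.inr (.inl ()))) = t ∧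
      ∀ j a, x (varEquiv Q (Option (Cell Γ)) N (.inr (.inr (j, a)))) =
        if a = τ j then 1 else 0 := by
  constructor
  · rintro rfl
    simp [point]
  · rintro ⟨h1, h2, h3⟩
    funext i
    obtain ⟨g, rfl⟩ := (varEquiv Q (Option (Cell Γ)) N).surjective i
    rcases g with q' | _ | ⟨j, a⟩
    · rw [h1]; simp [point]
    · rw [h2]; simp [point]
    · rw [h3]; simp [point]

/-! ### Unit vectors as the solutions of linear inequalities -/

section Rows

variable {S : Type} [Fintype S]

/-- The constraints that the variables `v` are nonnegative and have a sum of at most `1`. -/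
noncomputable def simplexRows {ι : Type} [Fintype ι] (v : ι → Window Q S) :
    List ((Window Q S → ℤ) × ℤ) :=
  (Finset.univ.toList.map fun i => (-windowVar (v i), 0)) ++ [(∑ i, windowVar (v i), 1)]

/-- The constraints that the variables `v` represent the value `i`. -/
noncomputable def valueRows {ι : Type} [Fintype ι] (v : ι → Window Q S) (i : ι) :
    List ((Window Q S → ℤ) × ℤ) :=
  simplexRows v ++ [(-windowVar (v i), -1)]

theorem forall_simplexRows {ι : Type} [Fintype ι] (v : ι → Window Q S) (y : Window Q S → ℚ) :
    (∀ R ∈ simplexRows v, windowForm R.1 y ≤ R.2) ↔ (∀ i, 0 ≤ y (v i)) ∧ ∑ i, y (v i) ≤ 1 := by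
  simp [simplexRows, windowForm_neg, windowForm_var, windowForm_sum,
    or_imp, forall_and]

/-- An entry of at least `1` uses up the whole sum, so the other nonnegative entries vanish. This
forces integrality although the loop ranges over the rationals. -/
theorem simplex_eq {ι : Type} [Fintype ι] [DecidableEq ι] (y : ι → ℚ) (i : ι) :
    ((∀ j, 0 ≤ y j) ∧ ∑ j, y j ≤ 1) ∧ 1 ≤ y i ↔ ∀ j, y j = if j = i then 1 else 0 := by
  constructor
  · rintro ⟨⟨h0, h1⟩, h2⟩ j
    rw [← Finset.add_sum_erase _ _ (Finset.mem_univ i)] at h1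
    have h3 : 0 ≤ ∑ j ∈ Finset.univ.erase i, y j := Finset.sum_nonneg fun j _ => h0 j
    split_ifs with h
    · subst h; linarith
    · have := Finset.single_le_sum (fun j _ => h0 j)
        (Finset.mem_erase.2 ⟨h, Finset.mem_univ j⟩)
      linarith [h0 j]
  · intro h
    simp only [h]
    refine ⟨⟨fun j => by split_ifs <;> norm_num, by simp⟩, by simp⟩

theorem forall_valueRows {ι : Type} [Fintype ι] [DecidableEq ι] (v : ι → Window Q S) (i : ι)
    (y : Window Q S → ℚ) :
    (∀ R ∈ valueRows v i, windowForm R.1 y ≤ R.2) ↔ ∀ j, y (v j) = if j = i then 1 else 0 := by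
  rw [← simplex_eq (fun j => y (v j)), valueRows, List.forall_mem_append, forall_simplexRows]
  simp [windowForm_neg, windowForm_var]

end Rows

/-- The variable of a symbol in the block `b` of a window. -/
abbrev blockVar {S : Type} (b : Fin 3) (a : S) : Window Q S := .inr (.inr (b, a))

/-! ### The constraint systems of the simulating loop -/

variable (input : Bool → Cell Γ)

/-- The initial symbol at a position. -/
def posSym : Pos → Option (Cell Γ)
  | .start => none
  | .bit b => some (input b)
  | .blank => some fun _ => none
  | .last => some fun _ => none

/-- The further constraints of the precondition at the ends. -/
noncomputable def initExtra : Pos → List ((Window Q (Option (Cell Γ)) → ℤ) × ℤ)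
  | .start => valueRows .inl M.start ++
    [(windowVar (.inr (.inl ())), 0), (-windowVar (.inr (.inl ())), 0)]
  | .bit _ => []
  | .blank => []
  -- Each position fixes the first block of its window, so blocks `N` and `N + 1` remain for the
  -- last position.
  | .last => valueRows (blockVar 1) (some fun _ => none) ++ valueRows (blockVar 2) none

/-- The precondition. -/
noncomputable def initRows (a : Pos) : List ((Window Q (Option (Cell Γ)) → ℤ) × ℤ) :=
  valueRows (blockVar 0) (posSym input a) ++ M.initExtra a

/-- The loop condition. -/
noncomputable def guardTests (_ : Pos) : List ((Window Q (Option (Cell Γ)) → ℤ) × ℤ) :=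
  [(windowVar (.inl M.accept), 0)]

/-- A constraint on the second state of a transition. -/
def onTarget {W : Type} (R : (W → ℤ) × ℤ) : (W → ℤ) × (W → ℤ) × ℤ := (0, R.1, R.2)

/-- The update. -/
noncomputable def updateTests (_ : Pos) :
    List ((Window Q (Option (Cell Γ)) → ℤ) × (Window Q (Option (Cell Γ)) → ℤ) × ℤ) :=
  (simplexRows .inl).map onTarget ++
  (simplexRows (blockVar 0)).map onTarget ++
  (simplexRows (blockVar 1)).map onTarget ++
  (simplexRows (blockVar 2)).map onTarget ++
  -- Control rule: the mark in the left block singles out the first window, whose middle block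
  -- contains the topmost symbols. The bound `2` is one less than the number of premises.
  (Finset.univ.toList.map fun p : Q × Cell Γ =>
    (windowVar (.inl p.1) + windowVar (blockVar 0 none) + windowVar (blockVar 1 (some p.2)),
      -windowVar (.inl (M.next p.1 p.2)), 2)) ++
  -- Local rule for the middle block, with four premises and hence the bound `3`.
  (Finset.univ.toList.map fun p : Q × Option (Cell Γ) × Option (Cell Γ) × Option (Cell Γ) =>
    (windowVar (.inl p.1) + windowVar (blockVar 0 p.2.1) + windowVar (blockVar 1 p.2.2.1) +
        windowVar (blockVar 2 p.2.2.2),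
      -windowVar (blockVar 1 (M.localStep p.1 p.2.1 p.2.2.1 p.2.2.2)), 3)) ++
  -- The end marks persist, and the counter increases by exactly `1`.
  [(windowVar (blockVar 0 none), -windowVar (blockVar 0 none), 0),
    (windowVar (blockVar 2 none), -windowVar (blockVar 2 none), 0),
    (-windowVar (.inr (.inl ())), windowVar (.inr (.inl ())), 1),
    (windowVar (.inr (.inl ())), -windowVar (.inr (.inl ())), -1)]

/-- The meaning of the update in a window. -/
theorem forall_updateTests (a : Pos) (y z : Window Q (Option (Cell Γ)) → ℚ) :
    (∀ R ∈ M.updateTests a, windowForm R.1 y + windowForm R.2.1 z ≤ R.2.2) ↔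
      (((∀ q, 0 ≤ z (.inl q)) ∧ ∑ q, z (.inl q) ≤ 1) ∧
        (∀ b, (∀ s, 0 ≤ z (blockVar b s)) ∧ ∑ s, z (blockVar b s) ≤ 1)) ∧
      (∀ q c, y (.inl q) + y (blockVar 0 none) + y (blockVar 1 (some c)) -
        z (.inl (M.next q c)) ≤ 2) ∧
      (∀ q l m r, y (.inl q) + y (blockVar 0 l) + y (blockVar 1 m) + y (blockVar 2 r) -
        z (blockVar 1 (M.localStep q l m r)) ≤ 3) ∧
      (y (blockVar 0 none) ≤ z (blockVar 0 none) ∧ y (blockVar 2 none) ≤ z (blockVar 2 none)) ∧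
      z (.inr (.inl ())) = y (.inr (.inl ())) + 1 := by
  have target : ∀ L : List ((Window Q (Option (Cell Γ)) → ℤ) × ℤ),
      (∀ R ∈ L.map onTarget, windowForm R.1 y + windowForm R.2.1 z ≤ R.2.2) ↔
        ∀ R ∈ L, windowForm R.1 z ≤ R.2 := by
    intro L
    rw [List.forall_mem_map]
    simp only [onTarget, windowForm_zero, zero_add]
  have last : z (.inr (.inl ())) = y (.inr (.inl ())) + 1 ↔
      -y (.inr (.inl ())) + z (.inr (.inl ())) ≤ 1 ∧ y (.inr (.inl ())) - z (.inr (.inl ())) ≤ -1 := by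
    constructor
    · intro h; constructor <;> linarith
    · rintro ⟨h1, h2⟩; linarith
  rw [last]
  simp only [updateTests, List.forall_mem_append, target, forall_simplexRows, Fin.forall_fin_succ,
    Fin.succ_zero_eq_one, Fin.succ_one_eq_two]
  simp only [List.forall_mem_map, Finset.mem_toList, Finset.mem_univ, forall_const, Prod.forall,
    windowForm_add, windowForm_neg, windowForm_var, List.forall_mem_cons, ← sub_eq_add_neg]
  simp [and_assoc]

/-- The loop that simulates the machine on the input word `w`, with `x` blank cells. -/
noncomputable def loop (w : List Bool) (x : ℕ) : SLCLoop :=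
  rowLoop (numVars Q (Option (Cell Γ)) (posWord w x).length)
    (stateRows (M.initRows input) (posWord w x)) (stateRows M.guardTests (posWord w x))
    (transRows M.updateTests (posWord w x))
    (List.length_pos_of_mem ((mem_stateRows _ _ _).2 ⟨⟨0, by simp [posWord]⟩, _,
      List.mem_append_left _ (List.mem_append_right _ (List.mem_singleton_self _)), rfl⟩))
    (List.length_pos_of_mem ((mem_stateRows _ _ _).2 ⟨⟨0, by simp [posWord]⟩, _,
      List.mem_singleton_self _, rfl⟩))
    (List.length_pos_of_mem ((mem_transRows _ _ _).2 ⟨⟨0, by simp [posWord]⟩, _,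
      List.mem_append_right _ (List.mem_cons_self), rfl⟩))

theorem loop_encode (w : List Bool) (x : ℕ) :
    (M.loop input w x).encode = loopText (Fintype.card (Option (Cell Γ)))
      (stateTemplates (M.initRows input)) (stateTemplates M.guardTests)
      (transTemplates M.updateTests) (posWord w x) :=
  rowLoop_encode _ _ _ _ _ _ _ (length_of_mem_stateRows _ _) (length_of_mem_stateRows _ _)
    (length_of_mem_transRows _ _)

end StackMachine

/-! ### Correctness of the simulating loop -/

namespace StackMachine

theorem getElem_posWord_succ (w : List Bool) (x k : ℕ) (h : k + 1 < (posWord w x).length) :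
    (posWord w x)[k + 1] = if hk : k < w.length then .bit w[k] else
      if k < w.length + x then .blank else .last := by
  have h' := h
  rw [length_posWord] at h'
  simp only [posWord, List.getElem_cons_succ]
  split_ifs with h1 h2
  · rw [List.getElem_append_left (by simpa using h1)]
    simp
  · rw [List.getElem_append_right (by simpa using h1), List.getElem_append_left (by simp; omega)]
    simp
  · rw [List.getElem_append_right (by simpa using h1), List.getElem_append_right (by simp; omega)]
    simp

theorem posSym_getElem_posWord {K : Type} {Γ : K → Type} {input : Bool → Cell Γ} {w : List Bool} (x : ℕ) {S : ∀ k, List (Γ k)}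
    (hS : ∀ k (j : ℕ), (S k)[j]? = w[j]?.elim none fun b => input b k) (k : ℕ)
    (h : k < (posWord w x).length) :
    posSym input (posWord w x)[k] = tape (posWord w x).length S k := by
  rcases k with _ | k
  · simp [posWord, posSym, tape]
  · rw [getElem_posWord_succ]
    have : 1 ≤ k + 1 ∧ k + 1 ≤ (posWord w x).length := by omega
    simp only [tape, this, and_self, if_true, Nat.add_sub_cancel, hS]
    split_ifs with h1 h2
    · simp [posSym, h1]
    · simp [posSym, h1]
    · simp [posSym, h1]

variable {Q K : Type} {Γ : K → Type} (M : StackMachine Q Γ)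
variable [Fintype Q] [Fintype K] [DecidableEq K] [∀ k, Fintype (Γ k)]
variable (input : Bool → Cell Γ) (w : List Bool) (x : ℕ)

variable {input w} in
-- The windows together fix every variable: the first fixes control and counter, each fixes its left
-- block, and the last fixes the two remaining blocks.
theorem forall_initRows_view {S : ∀ k, List (Γ k)}
    (hS : ∀ k (j : ℕ), (S k)[j]? = w[j]?.elim none fun b => input b k)
    (y : Fin (numVars Q (Option (Cell Γ)) (posWord w x).length) → ℚ) :
    (∀ k : Fin (posWord w x).length, ∀ R ∈ M.initRows input (posWord w x)[k],
      windowForm R.1 (view y k) ≤ R.2) ↔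
      y = point (posWord w x).length M.start 0 (tape (posWord w x).length S) := by
  classical
  have hlen := length_posWord w x
  have hsym := posSym_getElem_posWord x hS
  have h_last : ∀ (k : ℕ) (h : k < (posWord w x).length), (posWord w x)[k] = .last →
      k = w.length + x + 1 := by
    intro k h e
    rcases k with _ | k
    · cases e
    · rw [getElem_posWord_succ] at e
      split_ifs at e
      omega
  have hlast : ∀ (h : w.length + x + 1 < (posWord w x).length),
      (posWord w x)[w.length + x + 1] = .last := by
    intro h
    rw [getElem_posWord_succ]
    simp
  have hblank : tape (posWord w x).length S (w.length + x + 2) = some fun _ => none := by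
    have : 1 ≤ w.length + x + 2 ∧ w.length + x + 2 ≤ (posWord w x).length := by omega
    simp only [tape, this, and_self, if_true, hS]
    congr 1
    funext k
    rw [List.getElem?_eq_none (by omega)]
    rfl
  have hend : tape (posWord w x).length S (w.length + x + 3) = none := by
    have : ¬ (w.length + x + 3 ≤ (posWord w x).length) := by omega
    simp [tape, this]
  rw [eq_point_iff]
  simp only [initRows, List.forall_mem_append, forall_valueRows]
  constructor
  · intro h
    have h0 := h ⟨0, by omega⟩
    have hl := h ⟨w.length + x + 1, by omega⟩
    have e0 : (posWord w x)[(⟨0, by omega⟩ : Fin (posWord w x).length)] = .start := rfl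
    have el : (posWord w x)[(⟨w.length + x + 1, by omega⟩ : Fin (posWord w x).length)] = .last := hlast _
    rw [e0, initExtra, List.forall_mem_append, forall_valueRows] at h0
    rw [el, initExtra, List.forall_mem_append, forall_valueRows, forall_valueRows] at hl
    refine ⟨h0.2.1, ?_, fun j a => ?_⟩
    · have := h0.2.2
      simp only [List.forall_mem_cons, windowForm_neg, windowForm_var] at this
      have h1 := this.1
      have h2 := this.2.1
      simp only [view, Int.cast_zero] at h1 h2
      linarith
    · by_cases hj : (j : ℕ) < (posWord w x).length
      · have := (h ⟨j, hj⟩).1 a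
        rw [← hsym j hj]
        exact this
      · rcases (by omega : (j : ℕ) = w.length + x + 2 ∨ (j : ℕ) = w.length + x + 3) with e | e
        · rw [e, hblank]
          have := hl.2.1 a
          simp only [view] at this
          convert this
          simp
          omega
        · rw [e, hend]
          have := hl.2.2 a
          simp only [view] at this
          convert this
          simp
          omega
  · rintro ⟨h1, h2, h3⟩ k
    refine ⟨fun a => ?_, ?_⟩
    · refine (h3 _ a).trans ?_
      rw [show posSym input (posWord w x)[k] = tape (posWord w x).length S k from hsym k k.2]
      rfl
    · cases e : (posWord w x)[k] with
      | start =>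
        rw [initExtra, List.forall_mem_append, forall_valueRows]
        refine ⟨h1, ?_⟩
        simp [windowForm_neg, windowForm_var, view, h2]
      | bit b => simp [initExtra]
      | blank => simp [initExtra]
      | last =>
        have ek := h_last k (by omega) e
        rw [initExtra, List.forall_mem_append, forall_valueRows, forall_valueRows]
        refine ⟨fun a => (h3 _ a).trans ?_, fun a => (h3 _ a).trans ?_⟩
        · rw [← hblank]
          simp [ek]
        · rw [← hend]
          simp [ek]

theorem forall_guardTests_point (q : Q) (t : ℚ) (τ : ℕ → Option (Cell Γ)) :
    (∀ k : Fin (posWord w x).length, ∀ R ∈ M.guardTests (posWord w x)[k],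
      windowForm R.1 (view (point (posWord w x).length q t τ) k) ≤ R.2) ↔ q ≠ M.accept := by
  classical
  have h := ((eq_point_iff (point (posWord w x).length q t τ) q t τ).1 rfl).1 M.accept
  simp only [guardTests, List.mem_singleton, forall_eq, windowForm_var, view, h, Int.cast_zero]
  constructor
  · rintro h rfl
    have := h ⟨0, by simp [posWord]⟩
    simp at this
    linarith
  · intro h _
    simp [h.symm]

variable {x} in
-- For each unit vector of the successor some rule has all its premises equal to `1` and forces the
-- correct entry to be at least `1`; the simplex constraints do the rest. Conversely, the true
-- successor satisfies every rule, since a rule with a false premise is slack.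
theorem forall_updateTests_point (q : Q) (t : ℚ) (S : ∀ k, List (Γ k))
    (hS : ∀ k, (S k).length ≤ (posWord w x).length) (z : Fin (numVars Q (Option (Cell Γ)) (posWord w x).length) → ℚ) :
    (∀ k : Fin (posWord w x).length, ∀ R ∈ M.updateTests (posWord w x)[k],
      windowForm R.1 (view (point (posWord w x).length q t (tape (posWord w x).length S)) k) +
        windowForm R.2.1 (view z k) ≤ R.2.2) ↔
      z = point (posWord w x).length (M.step (q, S)).1 (t + 1)
        (tape (posWord w x).length (M.step (q, S)).2) := by
  classical
  have hlen : 0 < (posWord w x).length := by rw [length_posWord]; omega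
  rw [eq_point_iff]
  simp only [forall_updateTests]
  obtain ⟨p1, p2, p3⟩ := (eq_point_iff (point (posWord w x).length q t
    (tape (posWord w x).length S)) q t (tape (posWord w x).length S)).1 rfl
  have hstep := M.localStep_tape (posWord w x).length q S hS
  generalize (posWord w x).length = N at *
  have t0 : ∀ j, tape N S j = none ↔ j = 0 ∨ N + 1 ≤ j := by
    intro j
    simp only [tape]
    split_ifs with h
    · simp; omega
    · simp; omega
  have t0' : ∀ j, tape N (M.step (q, S)).2 j = none ↔ j = 0 ∨ N + 1 ≤ j := by
    intro j
    simp only [tape]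
    split_ifs with h
    · simp; omega
    · simp; omega
  have t1 : tape N S 1 = some fun k => (S k).head? := by
    simp only [tape, le_refl, true_and, show 1 ≤ N by omega, if_true]
    simp [List.head?_eq_getElem?]
  have t1' : ∀ (k : Fin N), ((k : ℕ) + ((1 : Fin 3) : ℕ)) = k + 1 := fun k => rfl
  have t2' : ∀ (k : Fin N), ((k : ℕ) + ((2 : Fin 3) : ℕ)) = k + 2 := fun k => rfl
  have tz' : ∀ (k : Fin N), ((k : ℕ) + ((0 : Fin 3) : ℕ)) = k := fun k => rfl
  simp only [view, p1, p2, p3, tz', t1', t2']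
  constructor
  · intro h
    refine ⟨?_, ?_, ?_⟩
    -- The control state is determined in the first window.
    · obtain ⟨⟨h0, -⟩, hc, -⟩ := h ⟨0, by omega⟩
      refine (simplex_eq _ _).1 ⟨h0, ?_⟩
      have := hc q fun k => (S k).head?
      simp only [(t0 0).2 (.inl rfl), zero_add, t1, if_true] at this
      simp only [step]
      linarith
    · exact (h ⟨0, by omega⟩).2.2.2.2
    · intro j
      rcases Nat.eq_zero_or_pos j with hj | hj
      · obtain ⟨⟨-, h0⟩, -, -, hf, -⟩ := h ⟨0, by omega⟩
        have e : (⟨0 + ((0 : Fin 3) : ℕ), by simp⟩ : Fin (N + 2)) = j := Fin.ext hj.symm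
        have h0 := h0 0
        have hf := hf.1
        simp only [(t0 0).2 (.inl rfl), if_true] at hf
        have e' : (⟨0, by omega⟩ : Fin (N + 2)) = j := Fin.ext hj.symm
        rw [(t0' j).2 (.inl hj)]
        rw [e] at h0
        rw [e'] at hf
        exact (simplex_eq _ _).1 ⟨h0, hf⟩
      rcases (show (j : ℕ) ≤ N ∨ (j : ℕ) = N + 1 by omega) with hj' | hj'
      -- Block `j` with `1 ≤ j ≤ N` is the middle block of window `j - 1`.
      · obtain ⟨⟨-, h0⟩, -, hl, -, -⟩ := h ⟨j - 1, by omega⟩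
        have e : (⟨(j : ℕ) - 1 + ((1 : Fin 3) : ℕ), by simp; omega⟩ : Fin (N + 2)) = j :=
          Fin.ext (by simp; omega)
        have h0 := h0 1
        have hl := hl q (tape N S (j - 1)) (tape N S j) (tape N S (j + 1))
        rw [hstep j hj hj'] at hl
        simp only [show (j : ℕ) - 1 + 1 = j by omega, show (j : ℕ) - 1 + 2 = j + 1 by omega,
          if_true] at hl
        rw [e] at h0
        change _ - z (varEquiv Q (Option (Cell Γ)) N (.inr (.inr (j, _)))) ≤ 3 at hl
        refine (simplex_eq _ _).1 ⟨h0, ?_⟩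
        simp only [step]
        linarith
      -- The right mark is the third block of the last window.
      · obtain ⟨⟨-, h0⟩, -, -, hf, -⟩ := h ⟨N - 1, by omega⟩
        have e : (⟨(N - 1) + ((2 : Fin 3) : ℕ), by simp; omega⟩ : Fin (N + 2)) = j :=
          Fin.ext (by simp; omega)
        have h0 := h0 2
        have hf := hf.2
        simp only [show N - 1 + 2 = N + 1 by omega, (t0 (N + 1)).2 (.inr le_rfl), if_true] at hf
        have e' : (⟨N + 1, by omega⟩ : Fin (N + 2)) = j := Fin.ext hj'.symm
        rw [(t0' j).2 (.inr hj'.ge)]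
        rw [e] at h0
        rw [e'] at hf
        exact (simplex_eq _ _).1 ⟨h0, hf⟩
  · rintro ⟨h1, h2, h3⟩ k
    simp only [h1, h2, h3]
    refine ⟨⟨((simplex_eq _ _).2 fun _ => rfl).1, fun b => ((simplex_eq _ _).2 fun _ => rfl).1⟩, ?_,
      ?_, ⟨?_, ?_⟩, trivial⟩
    · intro q' c
      by_cases e1 : q' = q
      swap; · simp only [e1, if_false]; split_ifs <;> norm_num
      by_cases e2 : none = tape N S k
      swap; · simp only [e2, if_false]; split_ifs <;> norm_num
      by_cases e3 : some c = tape N S (k + 1)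
      swap; · simp only [e3, if_false]; split_ifs <;> norm_num
      have hk : (k : ℕ) = 0 := by
        rcases (t0 k).1 e2.symm with h | h
        · exact h
        · omega
      rw [hk, zero_add, t1] at e3
      have e4 : M.next q' c = (M.step (q, S)).1 := by
        rw [e1, Option.some.inj e3]; rfl
      simp only [e4, if_true]
      split_ifs <;> norm_num
    · intro q' l m r
      by_cases e1 : q' = q
      swap; · simp only [e1, if_false]; split_ifs <;> norm_num
      by_cases e2 : l = tape N S k
      swap; · simp only [e2, if_false]; split_ifs <;> norm_num
      by_cases e3 : m = tape N S (k + 1)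
      swap; · simp only [e3, if_false]; split_ifs <;> norm_num
      by_cases e4 : r = tape N S (k + 2)
      swap; · simp only [e4, if_false]; split_ifs <;> norm_num
      have e5 : M.localStep q' l m r = tape N (M.step (q, S)).2 (k + 1) := by
        rw [e1, e2, e3, e4]
        exact hstep (k + 1) (by omega) (by omega)
      simp only [e5, if_true]
      split_ifs
      norm_num
    · have : none = tape N S k ↔ none = tape N (M.step (q, S)).2 k := by
        rw [@eq_comm _ none (tape N S _), @eq_comm _ none (tape _ _ _), t0, t0']
      simp only [this, le_refl]
    · have : none = tape N S (k + 2) ↔ none = tape N (M.step (q, S)).2 (k + 2) := by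
        rw [@eq_comm _ none (tape N S _), @eq_comm _ none (tape _ _ _), t0, t0']
      simp only [this, le_refl]

/-- The loop that simulates a machine has a linear ranking function if and only if the machine
accepts, provided that there is enough space. -/
theorem loop_correct {S : ∀ k, List (Γ k)}
    (hS : ∀ k (j : ℕ), (S k)[j]? = w[j]?.elim none fun b => input b k)
    (hlen : ∀ i k, ((M.step^[i] (M.start, S)).2 k).length ≤ (posWord w x).length) :
    (M.loop input w x).Deterministic ∧
      ((M.loop input w x).LinRF ↔ ∃ i, (M.step^[i] (M.start, S)).1 = M.accept) := by
  let tr : ℕ → Fin (numVars Q (Option (Cell Γ)) (posWord w x).length) → ℚ := fun i =>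
    point (posWord w x).length (M.step^[i] (M.start, S)).1 i
      (tape (posWord w x).length (M.step^[i] (M.start, S)).2)
  have htr : tr 0 = point (posWord w x).length M.start 0 (tape (posWord w x).length S) := by
    simp [tr]
  have hc : ∀ i, tr i (varEquiv Q (Option (Cell Γ)) (posWord w x).length (.inr (.inl ()))) = i :=
    fun i => ((eq_point_iff (tr i) _ (i : ℚ) _).1 rfl).2.1
  have h := rowLoop_correct_of_trace (hT := (M.loop input w x).r_pos)
    (hU := (M.loop input w x).p_pos) (hV := (M.loop input w x).q_pos)
    (T := stateRows (M.initRows input) (posWord w x)) (U := stateRows M.guardTests (posWord w x))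
    (V := transRows M.updateTests (posWord w x)) tr
    (fun i => (M.step^[i] (M.start, S)).1 ≠ M.accept)
    (fun y => (stateRows_holds (M.initRows input) (posWord w x) y).trans (by
      rw [htr]
      exact M.forall_initRows_view x hS y))
    (fun i => (stateRows_holds M.guardTests (posWord w x) (tr i)).trans
      (M.forall_guardTests_point w x _ _ _))
    (fun i y => (transRows_holds M.updateTests (posWord w x) (tr i) y).trans
      ((M.forall_updateTests_point w _ _ _ (hlen i) y).trans (by
        simp only [tr, Function.iterate_succ_apply', Nat.cast_succ])))
    _ hc
  refine ⟨h.1, h.2.trans ?_⟩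
  simp

end StackMachine

/-! ### Stack machines for Turing machines -/

namespace Micro

variable {K : Type} {Γ : K → Type} {Λ σ : Type}

/-- The statements that occur in the code of a machine. -/
abbrev Sub (m : Λ → TM2.Stmt Γ Λ σ) : Type := {s // ∃ l, s ∈ TM2.stmts₁ (m l)}

instance [Finite Λ] (m : Λ → TM2.Stmt Γ Λ σ) : Finite (Sub m) := by
  have : {s | ∃ l, s ∈ TM2.stmts₁ (m l)} = ⋃ l, (TM2.stmts₁ (m l) : Set (TM2.Stmt Γ Λ σ)) := by
    ext s; simp
  exact (this ▸ Set.finite_iUnion fun l => Finset.finite_toSet _ :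
    {s | ∃ l, s ∈ TM2.stmts₁ (m l)}.Finite).to_subtype

/-- The statement and the memory after one elementary operation. -/
def next (m : Λ → TM2.Stmt Γ Λ σ) : TM2.Stmt Γ Λ σ → σ → Cell Γ → TM2.Stmt Γ Λ σ × σ
  | .push _ _ q, v, _ => (q, v)
  | .peek k f q, v, o => (q, f v (o k))
  | .pop k f q, v, o => (q, f v (o k))
  | .load a q, v, _ => (q, a v)
  | .branch p q₁ q₂, v, _ => (cond (p v) q₁ q₂, v)
  | .goto f, v, _ => (m (f v), v)
  | .halt, v, _ => (.halt, v)

/-- Keeps the control within the finitely many statements that occur in the code. -/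
theorem next_mem (m : Λ → TM2.Stmt Γ Λ σ) (s : Sub m) (v : σ) (o : Cell Γ) :
    ∃ l, (next m s.1 v o).1 ∈ TM2.stmts₁ (m l) := by
  obtain ⟨s, l, hs⟩ := s
  have h : ∀ q, q ∈ TM2.stmts₁ s → ∃ l, q ∈ TM2.stmts₁ (m l) :=
    fun q hq => ⟨l, TM2.stmts₁_trans hs hq⟩
  cases s with
  | goto f => exact ⟨f v, TM2.stmts₁_self⟩
  | halt => exact ⟨l, hs⟩
  | branch p q₁ q₂ =>
    refine h _ ?_
    simp only [next, TM2.stmts₁, Finset.mem_insert, Finset.mem_union]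
    cases p v
    · exact .inr (.inr TM2.stmts₁_self)
    · exact .inr (.inl TM2.stmts₁_self)
  | _ =>
    refine h _ ?_
    simp only [next, TM2.stmts₁, Finset.mem_insert]
    exact .inr TM2.stmts₁_self

variable [DecidableEq K]

/-- The actions of one elementary operation on the stacks. -/
def act : TM2.Stmt Γ Λ σ → σ → ∀ k, StackAct (Γ k)
  | .push k f _, v, k' => if h : k = k' then .push (h ▸ f v) else .stay
  | .pop k _ _, _, k' => if k = k' then .pop else .stay
  | _, _, _ => .stay

open Classical in
/-- The stack machine that simulates a Turing machine and accepts when it halts with the symbol `y`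
on the stack `k₁`. -/
noncomputable def machine (m : Λ → TM2.Stmt Γ Λ σ) (main : Λ) (v : σ) (k₁ : K) (y : Γ k₁) :
    StackMachine (Option (Sub m × σ)) Γ where
  start := some (⟨m main, main, TM2.stmts₁_self⟩, v)
  accept := none
  next c o := c.elim none fun c => if c.1.1 = .halt ∧ o k₁ = some y then none else
    some (⟨(next m c.1.1 c.2 o).1, next_mem m c.1 c.2 o⟩, (next m c.1.1 c.2 o).2)
  act c := c.elim (fun _ => .stay) fun c => act c.1.1 c.2
  next_accept _ := rfl

/-- The number of symbols that a statement can push. -/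
def pushes : TM2.Stmt Γ Λ σ → ℕ
  | .push _ _ q => pushes q + 1
  | .peek _ _ q => pushes q
  | .pop _ _ q => pushes q
  | .load _ q => pushes q
  | .branch _ q₁ q₂ => pushes q₁ + pushes q₂
  | .goto _ => 0
  | .halt => 0

/-- The stacks after one elementary operation. -/
theorem stepAux_next (m : Λ → TM2.Stmt Γ Λ σ) (s : TM2.Stmt Γ Λ σ) (v : σ) (S : ∀ k, List (Γ k))
    (h1 : s ≠ .halt) (h2 : ∀ f, s ≠ .goto f) :
    TM2.stepAux (next m s v fun k => (S k).head?).1 (next m s v fun k => (S k).head?).2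
      (fun k => (act s v k).apply (S k)) = TM2.stepAux s v S := by
  cases s with
  | push k f q =>
    simp only [next, TM2.stepAux]
    congr 1
    funext k'
    by_cases h : k = k'
    · subst h; simp [act, StackAct.apply]
    · simp [act, StackAct.apply, h, Function.update_of_ne (Ne.symm h)]
  | pop k f q =>
    simp only [next, TM2.stepAux]
    congr 1
    funext k'
    by_cases h : k = k'
    · subst h; simp [act, StackAct.apply]
    · simp [act, StackAct.apply, h, Function.update_of_ne (Ne.symm h)]
  | branch p q₁ q₂ =>
    simp only [next, TM2.stepAux, act, StackAct.apply]
    cases p v <;> rfl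
  | goto f => exact absurd rfl (h2 f)
  | halt => exact absurd rfl h1
  | _ => rfl

/-- Stack length plus pushes still to come is a potential that cannot grow inside a statement. A
`goto` is excluded because it loads a new statement with its own pushes. -/
theorem length_act_le (m : Λ → TM2.Stmt Γ Λ σ) (s : TM2.Stmt Γ Λ σ) (v : σ) (S : ∀ k, List (Γ k))
    (o : Cell Γ) (h : ∀ f, s ≠ .goto f) (k : K) :
    ((act s v k).apply (S k)).length + pushes (next m s v o).1 ≤ (S k).length + pushes s := by
  cases s with
  | push k' f q =>
    simp only [act, next, pushes]
    split_ifs with h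
    · simp only [StackAct.apply, List.length_cons]; omega
    · simp only [StackAct.apply]; omega
  | pop k' f q =>
    simp only [act, next, pushes]
    split_ifs with h
    · simp [StackAct.apply]
    · simp [StackAct.apply]
  | branch p q₁ q₂ =>
    simp only [act, next, pushes, StackAct.apply]
    cases p v <;> simp
  | goto f => exact absurd rfl (h f)
  | _ => simp [act, next, pushes, StackAct.apply]

section Simulation

variable (m : Λ → TM2.Stmt Γ Λ σ) (main : Λ) (v₀ : σ) (k₁ : K) (y : Γ k₁)

theorem machine_step (s : Sub m) (v : σ) (S : ∀ k, List (Γ k))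
    (h : ¬ (s.1 = .halt ∧ (S k₁).head? = some y)) :
    (machine m main v₀ k₁ y).step (some (s, v), S) =
      (some (⟨(next m s.1 v fun k => (S k).head?).1, next_mem m s v _⟩,
        (next m s.1 v fun k => (S k).head?).2), fun k => (act s.1 v k).apply (S k)) := by
  simp [StackMachine.step, machine, h]

/-- The statement to be run in a configuration. -/
def stmtAt : Option Λ → TM2.Stmt Γ Λ σ
  | none => .halt
  | some l => m l

/-- One step of the Turing machine runs a whole statement. The stack machine spends one step on each
operation, including the final `goto`, and none on reaching `halt`. -/
theorem iterate_stepAux (s : TM2.Stmt Γ Λ σ) : ∀ (hs : ∃ l, s ∈ TM2.stmts₁ (m l)) (v : σ)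
    (S : ∀ k, List (Γ k)), ∃ (n : ℕ) (s' : Sub m), s'.1 = stmtAt m (TM2.stepAux s v S).l ∧
      (machine m main v₀ k₁ y).step^[n] (some (⟨s, hs⟩, v), S) =
        (some (s', (TM2.stepAux s v S).var), (TM2.stepAux s v S).stk) := by
  have key : ∀ (s : TM2.Stmt Γ Λ σ) (hs : ∃ l, s ∈ TM2.stmts₁ (m l)) (v : σ)
      (S : ∀ k, List (Γ k)), s ≠ .halt → (∀ f, s ≠ .goto f) →
      (∀ hs', ∃ (n : ℕ) (s' : Sub m), s'.1 = stmtAt m (TM2.stepAux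
          (next m s v fun k => (S k).head?).1 (next m s v fun k => (S k).head?).2
          (fun k => (act s v k).apply (S k))).l ∧
        (machine m main v₀ k₁ y).step^[n] (some (⟨(next m s v fun k => (S k).head?).1, hs'⟩,
          (next m s v fun k => (S k).head?).2), fun k => (act s v k).apply (S k)) =
          (some (s', (TM2.stepAux
          (next m s v fun k => (S k).head?).1 (next m s v fun k => (S k).head?).2
          (fun k => (act s v k).apply (S k))).var), (TM2.stepAux
          (next m s v fun k => (S k).head?).1 (next m s v fun k => (S k).head?).2
          (fun k => (act s v k).apply (S k))).stk)) →
      ∃ (n : ℕ) (s' : Sub m), s'.1 = stmtAt m (TM2.stepAux s v S).l ∧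
        (machine m main v₀ k₁ y).step^[n] (some (⟨s, hs⟩, v), S) =
          (some (s', (TM2.stepAux s v S).var), (TM2.stepAux s v S).stk) := by
    intro s hs v S h1 h2 h
    obtain ⟨n, s', h3, h4⟩ := h (next_mem m ⟨s, hs⟩ v _)
    rw [stepAux_next m s v S h1 h2] at h3 h4
    refine ⟨n + 1, s', h3, ?_⟩
    rw [Function.iterate_succ_apply, machine_step]
    · exact h4
    · exact fun h => h1 h.1
  induction s with
  | push k f q ih => exact fun hs v S => key _ hs v S (by simp) (by simp) fun hs' => ih hs' _ _
  | peek k f q ih => exact fun hs v S => key _ hs v S (by simp) (by simp) fun hs' => ih hs' _ _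
  | pop k f q ih => exact fun hs v S => key _ hs v S (by simp) (by simp) fun hs' => ih hs' _ _
  | load a q ih => exact fun hs v S => key _ hs v S (by simp) (by simp) fun hs' => ih hs' _ _
  | branch p q₁ q₂ ih₁ ih₂ =>
    refine fun hs v S => key _ hs v S (by simp) (by simp) fun hs' => ?_
    have ih : ∀ b, _ := fun b : Bool => show ∀ (hs' : ∃ l, cond b q₁ q₂ ∈ TM2.stmts₁ (m l)) (v : σ)
        (S : ∀ k, List (Γ k)), ∃ (n : ℕ) (s' : Sub m),
        s'.1 = stmtAt m (TM2.stepAux (cond b q₁ q₂) v S).l ∧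
        (machine m main v₀ k₁ y).step^[n] (some (⟨cond b q₁ q₂, hs'⟩, v), S) =
          (some (s', (TM2.stepAux (cond b q₁ q₂) v S).var),
            (TM2.stepAux (cond b q₁ q₂) v S).stk) by
      cases b
      · exact ih₂
      · exact ih₁
    exact ih (p v) hs' _ _
  | goto f =>
    intro hs v S
    refine ⟨1, ⟨m (f v), f v, TM2.stmts₁_self⟩, rfl, ?_⟩
    rw [Function.iterate_one, machine_step]
    · rfl
    · simp
  | halt => exact fun hs v S => ⟨0, ⟨_, hs⟩, rfl, rfl⟩

theorem iterate_of_reaches (S : ∀ k, List (Γ k)) (c : TM2.Cfg Γ Λ σ)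
    (h : Reaches (TM2.step m) ⟨some main, v₀, S⟩ c) :
    ∃ (n : ℕ) (s' : Sub m), s'.1 = stmtAt m c.l ∧
      (machine m main v₀ k₁ y).step^[n] ((machine m main v₀ k₁ y).start, S) =
        (some (s', c.var), c.stk) := by
  induction h with
  | refl => exact ⟨0, _, rfl, rfl⟩
  | @tail b c _ hc ih =>
    obtain ⟨n, s, hs, h1⟩ := ih
    obtain ⟨_ | l, v, T⟩ := b
    · simp [TM2.step] at hc
    · obtain rfl : TM2.stepAux (m l) v T = c := by simpa [TM2.step] using hc
      obtain ⟨n', s', h2, h3⟩ := iterate_stepAux m main v₀ k₁ y (m l) ⟨l, TM2.stmts₁_self⟩ v T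
      refine ⟨n' + n, s', h2, ?_⟩
      rw [Function.iterate_add_apply, h1, ← h3]
      congr 4
      exact Subtype.ext hs

/-- What holds in every configuration of the stack machine. -/
theorem machine_invariant (S : ∀ k, List (Γ k)) (A B : ℕ)
    (hA : ∀ c, Reaches (TM2.step m) ⟨some main, v₀, S⟩ c → ∀ k, (c.stk k).length ≤ A)
    (hB : ∀ l, A + pushes (m l) ≤ B) (n : ℕ) :
    (∀ k, (((machine m main v₀ k₁ y).step^[n] ((machine m main v₀ k₁ y).start, S)).2 k).length ≤
      B) ∧
    ∀ s v, ((machine m main v₀ k₁ y).step^[n] ((machine m main v₀ k₁ y).start, S)).1 =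
        some (s, v) →
      (∀ k, (((machine m main v₀ k₁ y).step^[n] ((machine m main v₀ k₁ y).start, S)).2 k).length +
        pushes s.1 ≤ B) ∧
      Reaches (TM2.step m) ⟨some main, v₀, S⟩ (TM2.stepAux s.1 v
        ((machine m main v₀ k₁ y).step^[n] ((machine m main v₀ k₁ y).start, S)).2) := by
  induction n with
  | zero =>
    have h0 : ∀ k, (S k).length ≤ A := hA _ .refl
    refine ⟨fun k => (h0 k).trans ((Nat.le_add_right _ _).trans (hB main)), ?_⟩
    rintro s v h
    obtain ⟨rfl, rfl⟩ := Prod.mk.inj (Option.some.inj h.symm)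
    -- Finishing the current statement always leads to a reachable configuration; here it is the
    -- first step of the Turing machine.
    exact ⟨fun k => (Nat.add_le_add_right (h0 k) _).trans (hB main), .single rfl⟩
  | succ n ih =>
    rw [Function.iterate_succ_apply']
    generalize (machine m main v₀ k₁ y).step^[n] ((machine m main v₀ k₁ y).start, S) = c at *
    obtain ⟨_ | ⟨s, v⟩, T⟩ := c
    · exact ⟨ih.1, fun s v h => by cases h⟩
    obtain ⟨h1, h2⟩ := ih.2 s v rfl
    by_cases hacc : s.1 = .halt ∧ (T k₁).head? = some y
    · have e : (machine m main v₀ k₁ y).step (some (s, v), T) = (none, T) := by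
        obtain ⟨⟨s, hs⟩, e1, e2⟩ := s, hacc
        simp only at e1
        subst e1
        simp only [StackMachine.step, machine, Option.elim]
        rw [if_pos ⟨rfl, e2⟩]
        rfl
      rw [e]
      exact ⟨ih.1, fun s v h => by cases h⟩
    · rw [machine_step m main v₀ k₁ y s v T hacc]
      have main_case : (∀ k, ((act s.1 v k).apply (T k)).length +
          pushes (next m s.1 v fun k => (T k).head?).1 ≤ B) ∧
          Reaches (TM2.step m) ⟨some main, v₀, S⟩ (TM2.stepAux
            (next m s.1 v fun k => (T k).head?).1 (next m s.1 v fun k => (T k).head?).2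
            (fun k => (act s.1 v k).apply (T k))) := by
        by_cases hg : ∃ f, s.1 = .goto f
        · obtain ⟨f, hf⟩ := hg
          rw [hf] at h2 ⊢
          -- At a `goto` the stacks are those of a reachable configuration, so the bound `A` applies
          -- afresh.
          exact ⟨fun k => (Nat.add_le_add_right (hA _ h2 k) _).trans (hB (f v)), h2.tail rfl⟩
        · push Not at hg
          refine ⟨fun k => (length_act_le m s.1 v T _ hg k).trans (h1 k), ?_⟩
          by_cases hh : s.1 = .halt
          · rw [hh] at h2 ⊢
            exact h2
          · rw [stepAux_next m s.1 v T hh hg]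
            exact h2
      refine ⟨fun k => (Nat.le_add_right _ _).trans (main_case.1 k), ?_⟩
      rintro s' v' h
      obtain ⟨rfl, rfl⟩ := Prod.mk.inj (Option.some.inj h.symm)
      exact main_case

/-- The stack machine accepts if and only if the Turing machine halts with `y`. -/
theorem machine_accepts_iff (S : ∀ k, List (Γ k)) (z : Γ k₁) (c : TM2.Cfg Γ Λ σ)
    (h : Reaches (TM2.step m) ⟨some main, v₀, S⟩ c) (hc : c.l = none)
    (hz : (c.stk k₁).head? = some z) (A B : ℕ)
    (hA : ∀ c, Reaches (TM2.step m) ⟨some main, v₀, S⟩ c → ∀ k, (c.stk k).length ≤ A)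
    (hB : ∀ l, A + pushes (m l) ≤ B) :
    (∃ n, ((machine m main v₀ k₁ y).step^[n] ((machine m main v₀ k₁ y).start, S)).1 =
      (machine m main v₀ k₁ y).accept) ↔ z = y := by
  have step_none : ∀ d : TM2.Cfg Γ Λ σ, d.l = none → ∀ e, e ∉ TM2.step m d := by
    rintro ⟨_ | l, v, T⟩ hd e he
    · simp [TM2.step] at he
    · cases hd
  -- By determinism one of two reachable configurations reaches the other, and a halted one reaches
  -- only itself.
  have uniq : ∀ d, Reaches (TM2.step m) ⟨some main, v₀, S⟩ d → d.l = none → d = c := by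
    intro d hd hl
    rcases reaches_total h hd with hcd | hcd
    · rcases Relation.ReflTransGen.cases_head hcd with e | ⟨e, he, -⟩
      · exact e.symm
      · exact absurd he (step_none c hc e)
    · rcases Relation.ReflTransGen.cases_head hcd with e | ⟨e, he, -⟩
      · exact e
      · exact absurd he (step_none d hl e)
  constructor
  · rintro ⟨n, hn⟩
    by_contra hzy
    -- Acceptance would need a `halt` statement with `y` on top. By the invariant these stacks would
    -- be those of `c`, whose top is `z`; so the machine stays at `halt` forever.
    have never : ∀ n, ((machine m main v₀ k₁ y).step^[n] ((machine m main v₀ k₁ y).start, S)).1 ≠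
        none := by
      intro n
      induction n with
      | zero => intro h; cases h
      | succ n ih =>
        have inv := (machine_invariant m main v₀ k₁ y S A B hA hB n).2
        rw [Function.iterate_succ_apply']
        generalize (machine m main v₀ k₁ y).step^[n] ((machine m main v₀ k₁ y).start, S) = d at *
        obtain ⟨_ | ⟨s, v⟩, T⟩ := d
        · exact absurd rfl ih
        · rw [machine_step]
          · simp
          · rintro ⟨hs, hT⟩
            have hr := (inv s v rfl).2
            rw [hs] at hr
            have e := uniq _ hr rfl
            rw [← e] at hz
            exact hzy (Option.some.inj (hz.symm.trans hT))
    exact never n hn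
  · rintro rfl
    obtain ⟨n, s, hs, hn⟩ := iterate_of_reaches m main v₀ k₁ z S c h
    refine ⟨n + 1, ?_⟩
    rw [Function.iterate_succ_apply', hn]
    rw [hc] at hs
    simp only [StackMachine.step, machine, Option.elim]
    rw [if_pos ⟨hs, hz⟩]

end Simulation

end Micro

/-! ### Polynomial bounds -/

theorem exists_monomial_bound (s : Polynomial ℕ) :
    ∃ c d : ℕ, ∀ n, s.eval n ≤ c * (n + 1) ^ d := by
  induction s using Polynomial.induction_on' with
  | add p q hp hq =>
    obtain ⟨c, d, h⟩ := hp
    obtain ⟨c', d', h'⟩ := hq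
    refine ⟨c + c', d + d', fun n => ?_⟩
    rw [Polynomial.eval_add, add_mul]
    exact Nat.add_le_add
      ((h n).trans (Nat.mul_le_mul_left _ (Nat.pow_le_pow_right (by omega) (by omega))))
      ((h' n).trans (Nat.mul_le_mul_left _ (Nat.pow_le_pow_right (by omega) (by omega))))
  | monomial d c =>
    refine ⟨c, d, fun n => ?_⟩
    rw [Polynomial.eval_monomial]
    exact Nat.mul_le_mul_left _ (Nat.pow_le_pow_left (by omega) _)

/-- Connects the iterates in `evals_in_steps` with the relation used by `InPSPACE`. -/
theorem reaches_of_iterate {α : Type*} (f : α → Option α) (n : ℕ) (a b : α)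
    (h : (flip bind f)^[n] (some a) = some b) : Reaches f a b := by
  induction n generalizing b with
  | zero => cases h; exact .refl
  | succ n ih =>
    rw [Function.iterate_succ_apply'] at h
    cases hc : (flip bind f)^[n] (some a) with
    | none => rw [hc] at h; cases h
    | some c => rw [hc] at h; exact (ih c hc).tail h

/-! ### The reduction -/

/-- Every language in PSPACE has a polynomial-time reduction to the existence of linear ranking
functions of deterministic loops. -/
theorem exists_reduction (L : Language Bool) (hL : InPSPACE L) :
    ∃ f : List Bool → SLCLoop,
      Nonempty (TM2ComputableInPolyTime (id : List Bool → List Bool) SLCLoop.encode f) ∧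
      ∀ w, (f w).Deterministic ∧ (w ∈ L ↔ (f w).LinRF) := by
  classical
  obtain ⟨T, hfin, s, hs⟩ := hL
  let _ := T.tm.kDecidableEq
  let _ := T.tm.kFin
  let _ := T.tm.ΛFin
  let _ := T.tm.σFin
  let _ : ∀ k, Fintype (T.tm.Γ k) := fun k => Fintype.ofFinite _
  let _ : Fintype (Micro.Sub T.tm.m) := Fintype.ofFinite _
  -- `InPSPACE` bounds the stacks only between steps; the constant makes room for the pushes within
  -- one statement. The form `c * (n + 1) ^ d` is what the program computes by multiplications.
  obtain ⟨c, d, hcd⟩ := exists_monomial_bound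
    (s + Polynomial.C (∑ l, Micro.pushes (T.tm.m l)))
  let M := Micro.machine T.tm.m T.tm.main T.tm.initialState T.tm.k₁ (T.outputAlphabet.invFun true)
  let input : Bool → Cell T.tm.Γ := fun b k =>
    if h : k = T.tm.k₀ then some (h ▸ T.inputAlphabet.invFun b) else none
  refine ⟨fun w => M.loop input w (c * (w.length + 1) ^ d), ?_, fun w => ?_⟩
  · obtain ⟨time, ht⟩ := exists_does_writeLoop c d (Fintype.card (Option (Cell T.tm.Γ)))
      (stateTemplates (M.initRows input)) (stateTemplates M.guardTests)
      (transTemplates M.updateTests)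
    refine StackProg.computable (k₀ := Stk.inp) (k₁ := Stk.out) _ time fun w =>
      (ht w).cast ?_ ?_ le_rfl
    · exact update_inp [] [] [] [] [] [] [] [] [] w ▸ by
        congr 1; funext k; cases k <;> rfl
    · rw [M.loop_encode]
      exact update_out [] [] [] [] [] [] [] [] [] _ ▸ by
        congr 1; funext k; cases k <;> rfl
  · set S : ∀ k, List (T.tm.Γ k) := (initList T.tm (w.map T.inputAlphabet.invFun)).stk with hSdef
    have hS : ∀ k (j : ℕ), (S k)[j]? = w[j]?.elim none fun b => input b k := by
      intro k j
      by_cases h : k = T.tm.k₀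
      · subst h
        simp only [hSdef, initList, input]
        cases hj : w[j]? <;> simp_all
      · simp only [hSdef, initList, input, h]
        cases w[j]? <;> simp
    have hreach : Reaches (TM2.step T.tm.m) ⟨some T.tm.main, T.tm.initialState, S⟩
        (haltList T.tm ((encodeBool (decide (w ∈ L))).map T.outputAlphabet.invFun)) :=
      reaches_of_iterate _ _ _ _ (T.outputsFun w).evals_in_steps
    have hA : ∀ cfg, Reaches (TM2.step T.tm.m) ⟨some T.tm.main, T.tm.initialState, S⟩ cfg →
        ∀ k, (cfg.stk k).length ≤ s.eval w.length := fun cfg h => hs w cfg h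
    have hB : ∀ l, s.eval w.length + Micro.pushes (T.tm.m l) ≤
        (posWord w (c * (w.length + 1) ^ d)).length := by
      intro l
      have h1 := hcd w.length
      have h2 : Micro.pushes (T.tm.m l) ≤ ∑ l, Micro.pushes (T.tm.m l) :=
        Finset.single_le_sum (f := fun l => Micro.pushes (T.tm.m l)) (fun _ _ => Nat.zero_le _)
          (Finset.mem_univ l)
      rw [Polynomial.eval_add, Polynomial.eval_C] at h1
      rw [length_posWord]
      omega
    have hz : ((haltList T.tm ((encodeBool (decide (w ∈ L))).map T.outputAlphabet.invFun)).stk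
        T.tm.k₁).head? = some (T.outputAlphabet.invFun (decide (w ∈ L))) := by
      simp [haltList, encodeBool]
    have hacc := Micro.machine_accepts_iff T.tm.m T.tm.main T.tm.initialState T.tm.k₁
      (T.outputAlphabet.invFun true) S _ _ hreach rfl hz _ _ hA hB
    have hloop := M.loop_correct input w (c * (w.length + 1) ^ d) hS fun i k =>
      (Micro.machine_invariant T.tm.m T.tm.main T.tm.initialState T.tm.k₁ _ S _ _ hA hB i).1 k
    refine ⟨hloop.1, ?_⟩
    rw [hloop.2]
    refine Iff.trans ?_ hacc.symm
    -- The machine halts with the code of `decide (w ∈ L)` on top, which is the code of `true`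
    -- exactly for members of `L`.
    exact (decide_eq_true_iff.symm).trans T.outputAlphabet.symm.injective.eq_iff.symm

theorem mainTheorem2 :
    PSPACEHard SLCLoop.encode (fun _ => True) SLCLoop.LinRF ∧
    PSPACEHard SLCLoop.encode SLCLoop.Deterministic SLCLoop.LinRF := by
  refine ⟨fun L hL => ?_, fun L hL => ?_⟩
  · obtain ⟨f, hf, h⟩ := exists_reduction L hL
    exact ⟨f, hf, fun w => ⟨trivial, (h w).2⟩⟩
  · exact exists_reduction L hL
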